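/- Call a complex-valued function $g$, holomorphic near a point $x\in\mathbb C^N$, \emph{Nash algebraic at $x$} if there is a nonzero polynomial $P\in\mathbb C[y_1,\dots,y_N,t]$ with $P(y,g(y))=0$ for all $y$ near $x$. Let $\mathcal N^m$ be the set of real-analytic functions $\xi:V\to\mathbb R$, $V\subset\mathbb C^m$ open, for which there is a holomorphic function $\tilde\xi$ on an open neighbourhood $W\subset\mathbb C^m\times\mathbb C^m$ of $\{(z,\bar z): z\in V\}$, Nash algebraic at each point of $W$, with $\tilde\xi(z,\bar z)=\xi(z)$ for $z\in V$. Let $\mathcal F$ be the set of germs at $0\in\mathbb C$ of the form $\xi(f_1,\dots,f_m)$ with $m>0$, $\xi\in\mathcal N^m$ defined on $V$, and $f_1,\dots,f_m$ germs of holomorphic functions at $0\in\mathbb C$ with $(f_1(0),\dots,f_m(0))\in V$. Let $\tilde{\mathcal F}$ be the set of those $\psi\in\mathcal F$ that are of diastasis-type, i.e. whose expansion $\psi(z)=\sum_{j,k\ge 0}a_{jk}z^j\bar z^k$ near $0$ has $a_{j0}=a_{0j}=0$ for all $j>0$. For $\mu_1,\dots,\mu_\ell\in\mathbb R$ put $$\tilde{\mathcal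 F}^{\mu_1}\cdots\tilde{\mathcal F}^{\mu_\ell}=\{\psi_1^{\mu_1}\cdots\psi_\ell^{\mu_\ell} : \psi_1,\dots,\psi_\ell\in\tilde{\mathcal F}\},$$ where products are taken pointwise near $0$ and $x^\mu$ is the usual real power wherever that is defined (with $0^0=1$); for the remaining pairs $(x,\mu)$ one sets $x^\mu=|x|^\mu\cos(\pi\mu)$ if $x<0$ and $0^\mu=0$ if $\mu<0$. Write $\mathbb R$ for the set of constant germs. \textbf{Theorem.} Let $\psi_0\in\tilde{\mathcal F}\setminus\mathbb R$. Then for every $\ell\ge 0$ and all $\mu_1,\dots,\mu_\ell\in\mathbb R$, $$e^{\psi_0}\notin\tilde{\mathcal F}^{\mu_1}\cdots\tilde{\mathcal F}^{\mu_\ell}\setminus\mathbb R .$$ -/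

import Mathlib

open Filter Topology

namespace NashDiastasis

/-- `g` is a holomorphic Nash algebraic function at the point `x ∈ ℂ^ι`: it is holomorphic near `x`
and satisfies a nontrivial polynomial equation `P(y, g(y)) = 0` near `x`.
The variable `none` of `P` stands for the value of `g`, the variable `some i` for the coordinate
`y i`. -/
def IsNashAt {ι : Type} [Fintype ι] (g : (ι → ℂ) → ℂ) (x : ι → ℂ) : Prop :=
  AnalyticAt ℂ g x ∧
    ∃ P : MvPolynomial (Option ι) ℂ, P ≠ 0 ∧
      ∀ᶠ y in 𝓝 x, MvPolynomial.eval (fun o : Option ι => o.elim (g y) y) P = 0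

/-- The point `(z, z̄)` of the diagonal of `ℂ^m × Conj ℂ^m`. -/
def diag {m : ℕ} (z : Fin m → ℂ) : Fin m ⊕ Fin m → ℂ :=
  Sum.elim z (fun j => starRingEnd ℂ (z j))

/-- The class `𝒩^m`: real analytic functions `ξ : V → ℝ` on an open set `V ⊆ ℂ^m` having an
extension `ξt` to an open neighbourhood `W` of the diagonal `{(z, z̄) : z ∈ V}` which is a
holomorphic Nash algebraic function. -/
def ClassN (m : ℕ) (V : Set (Fin m → ℂ)) (ξ : (Fin m → ℂ) → ℝ) : Prop :=
  IsOpen V ∧ AnalyticOnNhd ℝ ξ V ∧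
    ∃ (W : Set (Fin m ⊕ Fin m → ℂ)) (ξt : (Fin m ⊕ Fin m → ℂ) → ℂ),
      IsOpen W ∧ (∀ z ∈ V, diag z ∈ W) ∧ (∀ x ∈ W, IsNashAt ξt x) ∧
        ∀ z ∈ V, ξt (diag z) = (ξ z : ℂ)

/-- The class `ℱ` of the functions `ξ(f₁, …, f_m)` with `m > 0`, `ξ ∈ 𝒩^m` and `f₁, …, f_m`
holomorphic near `0 ∈ ℂ`. Its elements are germs at `0`, so membership depends only
on the values of `ψ` near `0`. -/
def ClassF : Set (ℂ → ℝ) :=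
  {ψ | ∃ m : ℕ, 0 < m ∧ ∃ (V : Set (Fin m → ℂ)) (ξ : (Fin m → ℂ) → ℝ) (f : Fin m → ℂ → ℂ),
    ClassN m V ξ ∧ (∀ j, AnalyticAt ℂ (f j) 0) ∧ (fun j => f j 0) ∈ V ∧
      ∀ᶠ z in 𝓝 (0 : ℂ), ψ z = ξ (fun j => f j z)}

/-- `ψ` is of diastasis-type at `0 ∈ ℂ`: its expansion `∑ a_{jk} z^j z̄^k` near `0` contains no
terms `z^j` or `z̄^j` with `j > 0`. -/
def IsDiastasisType (ψ : ℂ → ℝ) : Prop :=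
  ∃ a : ℕ → ℕ → ℂ,
    (∀ᶠ z in 𝓝 (0 : ℂ),
      HasSum (fun p : ℕ × ℕ => a p.1 p.2 * z ^ p.1 * (starRingEnd ℂ z) ^ p.2) (ψ z : ℂ)) ∧
    ∀ j, 0 < j → a j 0 = 0 ∧ a 0 j = 0

/-- The class `ℱ̃` of the elements of `ℱ` that are of diastasis-type. -/
def ClassFTilde : Set (ℂ → ℝ) :=
  {ψ | ψ ∈ ClassF ∧ IsDiastasisType ψ}

/-- The functions that are constant near `0` (the real numbers among the germs at `0`). -/
def Constants : Set (ℂ → ℝ) :=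
  {ψ | ∃ c : ℝ, ∀ᶠ z in 𝓝 (0 : ℂ), ψ z = c}

/-- The set `ℱ̃^{μ₁} ⋯ ℱ̃^{μ_ℓ}` of the products `ψ₁^{μ₁} ⋯ ψ_ℓ^{μ_ℓ}` with `ψ₁, …, ψ_ℓ ∈ ℱ̃`,
as germs at `0`. -/
def PowProd {ℓ : ℕ} (μ : Fin ℓ → ℝ) : Set (ℂ → ℝ) :=
  {φ | ∃ ψ : Fin ℓ → ℂ → ℝ, (∀ i, ψ i ∈ ClassFTilde) ∧
    ∀ᶠ z in 𝓝 (0 : ℂ), φ z = ∏ i, (ψ i z) ^ (μ i)}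

end NashDiastasis

/-! Taking logarithms, the relation makes ψ₀ a constant plus `∑ μᵢ log (ψᵢ / ψᵢ(0))`. Replacing z̄
by an independent variable w turns this into an identity of holomorphic germs Ψ₀ = c₀ + `∑ μᵢ log
(Ψᵢ / Ψᵢ(0))`. The Nash condition makes Ψ₀ and all Ψᵢ algebraic over functions of z alone and
functions of w alone (`exists_polarisation`, `isAlgebraic_of_isNashAt`).

Suppose the coefficient u(z) of some wⁿ in Ψ₀ is not constant. Then u is transcendental over ℂ and
belongs to a transcendence basis, so there is a derivation D with D u = 1 that kills the other basis
elements; acting on coefficients, it also kills functions of w. Since Ψᵢ(z, 0) is constant by the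
diastasis condition, logarithms differentiate as expected: D Ψ₀ = `∑ μᵢ D Ψᵢ / Ψᵢ`. Everything here
is algebraic over C(u), where C is the field of constants of D.

Such a relation forces D Ψ₀ = 0 (`derivation_eq_zero_of_eq_sum_logDeriv`). Otherwise D can be
rescaled so that Ψ₀ becomes a variable of derivative 1, and norms bring the relation down to C(Ψ₀);
there logarithmic derivatives vanish at infinity and cannot add up to a nonzero constant. But the
coefficient of wⁿ in D Ψ₀ is D u = 1, a contradiction (`coeff_mem_range_of_eq_sum_log`). Hence Ψ₀
depends on w alone, and since Ψ₀(0, w) is constant by the diastasis condition, so is ψ₀. -/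

namespace NashDiastasis

/-! ### Derivations and transcendence bases -/

open TensorProduct in
/-- Derivations extend along formally étale algebras. -/
theorem exists_derivation_extending {R S T : Type*} [CommRing R] [CommRing S] [CommRing T]
    [Algebra R S] [Algebra R T] [Algebra S T] [IsScalarTower R S T] [Algebra.FormallyEtale S T]
    (d : Derivation R S T) : ∃ D : Derivation R T T, ∀ s, D (algebraMap S T s) = d s := by
  let e := KaehlerDifferential.tensorKaehlerEquivOfFormallyEtale R S T
  let l : T ⊗[S] Ω[S⁄R] →ₗ[T] T := LinearMap.liftBaseChange T d.liftKaehlerDifferential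
  refine ⟨(l ∘ₗ e.symm.toLinearMap).compDer (KaehlerDifferential.D R T), fun s => ?_⟩
  have h := KaehlerDifferential.tensorKaehlerEquivOfFormallyEtale_symm_D_algebraMap R S T s
  simp [e, l, h]

/-- In characteristic zero, the members of an algebraically independent set have partial
derivatives on any field extension. -/
theorem exists_derivation_of_algebraicIndepOn {k K : Type*} [Field k] [CharZero k] [Field K]
    [Algebra k K] {B : Set K} (hB : AlgebraicIndepOn k id B) {u : K} (hu : u ∈ B) :
    ∃ D : Derivation k K K, D u = 1 ∧ ∀ b ∈ B, b ≠ u → D b = 0 := by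
  classical
  obtain ⟨B', hBB', hB'⟩ := exists_isTranscendenceBasis_superset hB
  let R := MvPolynomial B' k
  let φ : R →ₐ[k] K := MvPolynomial.aeval ((↑) : B' → K)
  have hφ : Function.Injective φ := hB'.1
  let _ : Algebra R K := φ.toRingHom.toAlgebra
  have hmap : algebraMap R K = φ.toRingHom := rfl
  have : IsScalarTower k R K := .of_algebraMap_eq fun r => (φ.commutes r).symm
  have : FaithfulSMul R K := (faithfulSMul_iff_algebraMap_injective R K).mpr hφ
  let Q := FractionRing R
  let _ : Algebra Q K := FractionRing.liftAlgebra R K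
  have : IsScalarTower R Q K := FractionRing.isScalarTower_liftAlgebra R K
  have : CharZero R := charZero_of_injective_algebraMap (algebraMap k R).injective
  have : CharZero Q := charZero_of_injective_algebraMap (IsFractionRing.injective R Q)
  have : Algebra.IsAlgebraic R K := by
    have := hB'.isAlgebraic
    let e := hB'.1.aevalEquiv
    let _ : Algebra (Algebra.adjoin k (Set.range ((↑) : B' → K))) R :=
      e.symm.toRingEquiv.toRingHom.toAlgebra
    have : IsScalarTower (Algebra.adjoin k (Set.range ((↑) : B' → K))) R K :=
      .of_algebraMap_eq fun x => by
        have h := hB'.1.algebraMap_aevalEquiv (e.symm x)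
        rw [AlgEquiv.apply_symm_apply] at h
        exact h
    exact .extendScalars (R := Algebra.adjoin k (Set.range ((↑) : B' → K))) e.symm.injective
  have : Algebra.IsAlgebraic Q K := IsFractionRing.comap_isAlgebraic_iff.mp this
  -- Localizations are formally étale, and so are algebraic field extensions in characteristic zero.
  -- Hence a derivation of the polynomial ring on the basis extends to `K`.
  have : Algebra.FormallyEtale R Q := .of_isLocalization (nonZeroDivisors R)
  have : Algebra.FormallyEtale Q K := .of_isSeparable Q K
  have : Algebra.FormallyEtale R K := .comp R Q K
  obtain ⟨D, hD⟩ := exists_derivation_extending (R := k) (S := R) (T := K)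
    (MvPolynomial.mkDerivation k fun b : B' => if (b : K) = u then 1 else 0)
  have hX (b : B') : D b = if (b : K) = u then 1 else 0 := by
    have h := hD (MvPolynomial.X b)
    rwa [MvPolynomial.mkDerivation_X, hmap, AlgHom.toRingHom_eq_coe, RingHom.coe_coe,
      MvPolynomial.aeval_X] at h
  refine ⟨D, by simpa using hX ⟨u, hBB' hu⟩, fun b hb hbu => ?_⟩
  simpa [hbu] using hX ⟨b, hBB' hb⟩

/-- A transcendental element can be completed to a transcendence basis of a set. -/
theorem exists_algebraicIndepOn_insert {k K : Type*} [Field k] [Field K] [Algebra k K] {u : K}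
    (hu : Transcendental k u) (s : Set K) :
    ∃ B : Set K, u ∈ B ∧ B ⊆ insert u s ∧ AlgebraicIndepOn k id B ∧
      ∀ a ∈ s, IsAlgebraic (Algebra.adjoin k B) a := by
  have h0 : AlgebraicIndepOn k id {u} := by
    have : AlgebraicIndepOn k id (∅ : Set K) :=
      (algebraicIndependent_empty_iff ..).mpr (algebraMap k K).injective
    have h1 := this.insert (i := u) (by
      rw [Set.image_empty, Algebra.adjoin_empty]
      intro h
      refine hu (h.restrictScalars k))
    simpa using h1
  obtain ⟨B, huB, hB⟩ := exists_maximal_algebraicIndependent {u} (insert u s) (by simp) h0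
  refine ⟨B, by simpa using huB, hB.1.2, hB.1.1, fun a ha => ?_⟩
  by_cases haB : a ∈ B
  · exact isAlgebraic_algebraMap (⟨a, Algebra.subset_adjoin haB⟩ : Algebra.adjoin k B)
  by_contra hna
  exact haB (hB.2 ⟨hB.1.1.insert (by rwa [Set.image_id]),
    Set.insert_subset (Set.mem_insert_of_mem _ ha) hB.1.2⟩ (Set.subset_insert a B)
    (Set.mem_insert a B))

/-! ### Liouville-type theorem for logarithmic derivatives -/

open Differential in
-- Automorphisms over `F` commute with the derivation, so the relation may be summed over its
-- conjugates. The logarithmic derivative turns the norm into this sum, and the left side is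
-- multiplied by the order of the Galois group.
theorem exists_sum_logDeriv_of_isGalois {F K : Type*} [Field F] [Field K] [Differential F]
    [Differential K] [Algebra F K] [DifferentialAlgebra F K] [CharZero F] [FiniteDimensional F K]
    [IsGalois F K] {ι : Type*} [Fintype ι] (a : F) (c : ι → F) (y : ι → K) (hy : ∀ i, y i ≠ 0)
    (h : algebraMap F K a = ∑ i, algebraMap F K (c i) * logDeriv (y i)) :
    ∃ n : ℕ, n ≠ 0 ∧ ∃ r : ι → F, (∀ i, r i ≠ 0) ∧ n * a = ∑ i, c i * logDeriv (r i) := by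
  refine ⟨Fintype.card (K ≃ₐ[F] K), Fintype.card_ne_zero, fun i => Algebra.norm F (y i),
    fun i => Algebra.norm_ne_zero_iff.mpr (hy i), ?_⟩
  apply (algebraMap F K).injective
  simp only [map_mul, map_sum, map_natCast, ← logDeriv_algebraMap,
    Algebra.norm_eq_prod_automorphisms]
  have hσ (i : ι) : logDeriv (∏ σ : K ≃ₐ[F] K, σ (y i)) =
      ∑ σ : K ≃ₐ[F] K, logDeriv (σ (y i)) :=
    logDeriv_prod _ _ _ fun σ _ => by simpa using hy i
  simp_rw [hσ, Finset.mul_sum]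
  rw [Finset.sum_comm]
  trans ∑ _σ : K ≃ₐ[F] K, algebraMap F K a
  · simp
  · refine Finset.sum_congr rfl fun σ _ => ?_
    have h' := congrArg σ h
    simp only [AlgEquiv.commutes, map_sum, map_mul] at h'
    rw [h']
    refine Finset.sum_congr rfl fun i _ => ?_
    simp [Differential.logDeriv, algEquiv_deriv']

open Differential in
/-- Taking norms turns a relation between logarithmic derivatives in a finite extension into such
a relation in the base field. -/
theorem exists_sum_logDeriv_of_finiteDimensional {F K : Type*} [Field F] [Field K] [Differential F]
    [Differential K] [Algebra F K] [DifferentialAlgebra F K] [CharZero F] [FiniteDimensional F K]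
    {ι : Type*} [Fintype ι] (a : F) (c : ι → F) (y : ι → K) (hy : ∀ i, y i ≠ 0)
    (h : algebraMap F K a = ∑ i, algebraMap F K (c i) * logDeriv (y i)) :
    ∃ n : ℕ, n ≠ 0 ∧ ∃ r : ι → F, (∀ i, r i ≠ 0) ∧ n * a = ∑ i, c i * logDeriv (r i) := by
  -- In characteristic zero the normal closure is Galois, and the embedding of `K` commutes with the
  -- derivations.
  let N := IntermediateField.normalClosure F K (AlgebraicClosure K)
  let f : K →ₐ[F] N := IsScalarTower.toAlgHom F K N
  have h' := congrArg f h
  simp only [AlgHom.commutes, map_sum, map_mul] at h'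
  refine exists_sum_logDeriv_of_isGalois (K := N) a c (fun i => f (y i))
    (fun i => by simpa using hy i) (h'.trans (Finset.sum_congr rfl fun i _ => ?_))
  simp only [Differential.logDeriv, map_div₀, algHom_deriv' f f.injective]

/-- Derivations vanish on separable algebraic elements. -/
theorem derivation_eq_zero_of_isAlgebraic {C L : Type*} [Field C] [CharZero C] [Field L]
    [Algebra C L] (D : Derivation C L L) {y : L} (hy : IsAlgebraic C y) : D y = 0 := by
  have h := D.map_aeval (minpoly C y) y
  rw [minpoly.aeval, map_zero, eq_comm, smul_eq_mul] at h
  exact (mul_eq_zero.mp h).resolve_left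
    ((minpoly.irreducible hy.isIntegral).separable.aeval_derivative_ne_zero (minpoly.aeval C y))

/-- The exchange property of algebraic dependence. -/
theorem isAlgebraic_adjoin_singleton_of_transcendental {C L : Type*} [Field C] [Field L]
    [Algebra C L] {x y z : L} (hy : Transcendental C y) (hyx : IsAlgebraic (Algebra.adjoin C {x}) y)
    (hz : IsAlgebraic (Algebra.adjoin C {x}) z) : IsAlgebraic (Algebra.adjoin C {y}) z := by
  have hcl (s : Set L) (a : L) : a ∈ (AlgebraicIndependent.matroid C L).closure s ↔
      IsAlgebraic (Algebra.adjoin C s) a := by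
    rw [AlgebraicIndependent.matroid_closure_eq]
    rfl
  rw [← hcl] at hyx hz ⊢
  have h0 : y ∉ (AlgebraicIndependent.matroid C L).closure ∅ := by
    rw [hcl, Algebra.adjoin_empty]
    exact fun h => hy (h.restrictScalars C)
  have hx := Matroid.closure_exchange (M := AlgebraicIndependent.matroid C L) (X := ∅) (e := y)
    (f := x) ⟨by simpa using hyx, h0⟩
  have hx' : x ∈ (AlgebraicIndependent.matroid C L).closure {y} := by simpa using hx.1
  exact Matroid.closure_subset_closure_of_subset_closure (by simpa using hx') hz

open Polynomial in
/-- A logarithmic derivative of a rational function has negative degree, so it is not a nonzero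
constant. -/
theorem sum_logDeriv_polynomial_ne {C : Type*} [Field C] {ι : Type*} [Fintype ι] [DecidableEq ι]
    (p : ι → C[X]) (hp : ∀ i, p i ≠ 0) (μ : ι → C) {n : C} (hn : n ≠ 0) :
    Polynomial.C n * ∏ i, p i ≠
      ∑ i, Polynomial.C (μ i) * (derivative (p i) * ∏ j ∈ Finset.univ.erase i, p j) := by
  intro h
  have hP : ∏ i, p i ≠ 0 := Finset.prod_ne_zero_iff.mpr fun i _ => hp i
  have hlt : (∑ i, Polynomial.C (μ i) * (derivative (p i) *
      ∏ j ∈ Finset.univ.erase i, p j)).degree < (∏ i, p i).degree := by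
    refine (Finset.sum_induction _ (fun q : C[X] => q.degree < (∏ i, p i).degree)
      (fun a b ha hb => (degree_add_le a b).trans_lt (max_lt ha hb))
      (by simpa [bot_lt_iff_ne_bot] using hP) fun i _ => ?_)
    rw [← smul_eq_C_mul]
    refine (degree_smul_le _ _).trans_lt ?_
    rw [← Finset.mul_prod_erase Finset.univ p (Finset.mem_univ i), degree_mul, degree_mul]
    refine WithBot.add_lt_add_right ?_ (degree_derivative_lt (hp i))
    exact degree_eq_bot.not.mpr (Finset.prod_ne_zero_iff.mpr fun i _ => hp i)
  rw [← h, degree_C_mul hn] at hlt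
  exact lt_irrefl _ hlt

open Polynomial in
-- Since `D x = 1`, the element `x` is transcendental over `C` and `D` acts on `C[x]` as `d/dx`.
-- Clearing denominators leaves an identity in `C[X]` that is excluded by degree.
theorem sum_logDeriv_aeval_ne {C L : Type*} [Field C] [CharZero C] [Field L] [Algebra C L]
    (D : Derivation C L L) {x : L} (hx : D x = 1) {ι : Type*} [Fintype ι] (p : ι → C[X])
    (hp : ∀ i, p i ≠ 0) (μ : ι → C) {n : C} (hn : n ≠ 0) :
    algebraMap C L n ≠ ∑ i, algebraMap C L (μ i) * (D (aeval x (p i)) / aeval x (p i)) := by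
  classical
  intro h
  have hxt : Transcendental C x := fun hx' => by
    rw [derivation_eq_zero_of_isAlgebraic D hx'] at hx
    exact zero_ne_one hx
  have hinj := transcendental_iff_injective.mp hxt
  have hp' (i : ι) : aeval x (p i) ≠ 0 := fun h0 => hp i (hinj (by simpa using h0))
  apply sum_logDeriv_polynomial_ne p hp μ hn
  apply hinj
  simp only [map_mul, aeval_C, map_prod, map_sum, h, Finset.sum_mul]
  refine Finset.sum_congr rfl fun i _ => ?_
  rw [← Finset.mul_prod_erase Finset.univ _ (Finset.mem_univ i), D.map_aeval, hx]
  have := hp' i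
  simp only [smul_eq_mul, mul_one]
  field_simp

open IntermediateField Differential in
-- `D` preserves `C(x)`, and the `y i` generate a finite extension of it. Norms carry the relation
-- down to `C(x)`; writing each norm as `p / q` doubles the index set, the denominators entering
-- with exponents `-μ i`.
theorem sum_logDeriv_ne_one {C L : Type*} [Field C] [CharZero C] [Field L] [Algebra C L]
    (D : Derivation C L L) {x : L} (hx : D x = 1) {ι : Type*} [Fintype ι] (μ : ι → C) (y : ι → L)
    (hy0 : ∀ i, y i ≠ 0) (hy : ∀ i, IsAlgebraic C⟮x⟯ (y i)) :
    1 ≠ ∑ i, algebraMap C L (μ i) * (D (y i) / y i) := by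
  intro h
  have hE (e : L) (he : e ∈ C⟮x⟯) : D e ∈ C⟮x⟯ := by
    induction he using IntermediateField.adjoin_induction with
    | mem a ha =>
      rw [Set.mem_singleton_iff.mp ha, hx]
      exact one_mem _
    | algebraMap c => simp
    | add a b ha hb iha ihb => simpa using add_mem iha ihb
    | inv a ha iha =>
      simp only [D.leibniz_inv, smul_eq_mul]
      exact mul_mem (neg_mem (pow_mem (inv_mem ha) 2)) iha
    | mul a b ha hb iha ihb =>
      simp only [D.leibniz, smul_eq_mul]
      exact add_mem (mul_mem ha ihb) (mul_mem hb iha)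
  let d : Derivation ℤ C⟮x⟯ C⟮x⟯ := Derivation.mk'
    { toFun := fun e => ⟨D e, hE e e.2⟩
      map_add' := fun a b => Subtype.ext (by simp)
      map_smul' := fun a b => Subtype.ext (by simp) }
    fun a b => Subtype.ext (by simp)
  let _ : Differential C⟮x⟯ := ⟨d⟩
  let _ : Differential L := ⟨D.restrictScalars ℤ⟩
  have : DifferentialAlgebra C⟮x⟯ L := ⟨fun _ => rfl⟩
  have : CharZero C⟮x⟯ := charZero_of_injective_algebraMap (algebraMap C C⟮x⟯).injective
  let N := IntermediateField.adjoin C⟮x⟯ (Set.range y)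
  have : FiniteDimensional C⟮x⟯ N := finiteDimensional_adjoin fun z hz => by
    obtain ⟨i, rfl⟩ := hz
    exact (hy i).isIntegral
  let y' (i : ι) : N := ⟨y i, subset_adjoin _ _ ⟨i, rfl⟩⟩
  have hy' (i : ι) : ((Differential.logDeriv (y' i) : N) : L) = D (y i) / y i :=
    (logDeriv_algebraMap (y' i)).symm
  obtain ⟨n, hn, r, hr0, hr⟩ := exists_sum_logDeriv_of_finiteDimensional (1 : C⟮x⟯)
    (fun i => algebraMap C C⟮x⟯ (μ i)) y' (fun i h0 => hy0 i (congrArg Subtype.val h0)) (by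
      apply Subtype.val_injective
      rw [AddSubmonoidClass.coe_finsetSum]
      simpa [hy'] using h)
  have hr' (i : ι) : ∃ p q : Polynomial C, p ≠ 0 ∧ q ≠ 0 ∧
      (r i : L) = Polynomial.aeval x p / Polynomial.aeval x q := by
    obtain ⟨p, q, hpq⟩ := mem_adjoin_simple_iff C (r i : L) |>.mp (r i).2
    have h0 : (r i : L) ≠ 0 := fun h0 => hr0 i (Subtype.ext h0)
    exact ⟨p, q, by rintro rfl; simp [hpq] at h0, by rintro rfl; simp [hpq] at h0, hpq⟩
  choose p q hp hq hpq using hr'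
  have hxt : Transcendental C x := fun hx' => by
    rw [derivation_eq_zero_of_isAlgebraic D hx'] at hx
    exact zero_ne_one hx
  have hinj := transcendental_iff_injective.mp hxt
  have hne {s : Polynomial C} (hs : s ≠ 0) : Polynomial.aeval x s ≠ 0 :=
    fun h0 => hs (hinj (by simpa using h0))
  refine sum_logDeriv_aeval_ne D hx (Sum.elim p q) (Sum.rec hp hq) (Sum.elim μ fun i => -μ i)
    (n := (n : C)) (by exact_mod_cast hn) ?_
  have hrL := congrArg (algebraMap C⟮x⟯ L) hr
  simp only [map_mul, map_sum, map_natCast, ← logDeriv_algebraMap, mul_one] at hrL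
  rw [map_natCast, hrL, Fintype.sum_sum_type, ← Finset.sum_add_distrib]
  refine Finset.sum_congr rfl fun i _ => ?_
  have h1 : algebraMap C⟮x⟯ L (r i) = Polynomial.aeval x (p i) / Polynomial.aeval x (q i) := hpq i
  rw [h1, logDeriv_div _ _ (hne (hp i)) (hne (hq i))]
  simp only [Sum.elim_inl, Sum.elim_inr, map_neg]
  change algebraMap C L (μ i) * (D _ / _ - D _ / _) = _
  ring

open IntermediateField algebraAdjoinAdjoin in
/-- A function algebraic over a field of transcendence degree one over the constants is not a
linear combination of logarithms of such functions. -/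
theorem derivation_eq_zero_of_eq_sum_logDeriv {C L : Type*} [Field C] [CharZero C] [Field L]
    [Algebra C L] (D : Derivation C L L) {x y₀ : L} {ι : Type*} [Fintype ι] (μ : ι → C) (y : ι → L)
    (hy0 : ∀ i, y i ≠ 0) (h₀ : IsAlgebraic (Algebra.adjoin C {x}) y₀)
    (hy : ∀ i, IsAlgebraic (Algebra.adjoin C {x}) (y i))
    (h : D y₀ = ∑ i, algebraMap C L (μ i) * (D (y i) / y i)) : D y₀ = 0 := by
  by_contra hD
  have hyt : Transcendental C y₀ := fun h' => hD (derivation_eq_zero_of_isAlgebraic D h')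
  -- Rescaling `D` gives `y₀` derivative 1. By exchange `y₀` replaces `x` as the variable over which
  -- every `y i` is algebraic.
  refine sum_logDeriv_ne_one ((D y₀)⁻¹ • D) (x := y₀) (by simp [hD]) μ y hy0 (fun i => ?_) ?_
  · have := isAlgebraic_adjoin_singleton_of_transcendental hyt h₀ (hy i)
    exact this.extendScalars (S := C⟮y₀⟯) (FaithfulSMul.algebraMap_injective _ _)
  · rw [← inv_mul_cancel₀ hD]
    conv_lhs => rw [h, Finset.mul_sum]
    refine Finset.sum_congr rfl fun i _ => ?_
    simp only [Derivation.smul_apply, smul_eq_mul, h]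
    ring

/-! ### Derivations acting on coefficients, and formal logarithms -/

section

open PowerSeries

/-- The derivation of a power series ring that applies `D` to the coefficients. -/
noncomputable def coeffDerivation {k K : Type*} [Field k] [Field K] [Algebra k K]
    (D : Derivation k K K) : Derivation k K⟦X⟧ K⟦X⟧ :=
  Derivation.mk'
    { toFun := fun f => PowerSeries.mk fun n => D (coeff n f)
      map_add' := fun f g => by ext; simp
      map_smul' := fun c f => by ext; simp }
    fun f g => by
      ext n
      simp only [LinearMap.coe_mk, AddHom.coe_mk, coeff_mk, coeff_mul, map_sum, D.leibniz,
        smul_eq_mul, map_add, Finset.sum_add_distrib]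
      congr 1
      exact Finset.sum_bij' (fun p _ => p.swap) (fun p _ => p.swap) (by simp [add_comm])
        (by simp [add_comm]) (by simp) (by simp) (by simp)

theorem coeff_coeffDerivation {k K : Type*} [Field k] [Field K] [Algebra k K]
    (D : Derivation k K K) (f : K⟦X⟧) (n : ℕ) : coeff n (coeffDerivation D f) = D (coeff n f) :=
  coeff_mk n fun n => D (coeff n f)

theorem derivative_coeffDerivation {k K : Type*} [Field k] [Field K] [Algebra k K]
    (D : Derivation k K K) (f : K⟦X⟧) :
    derivative K (coeffDerivation D f) = coeffDerivation D (derivative K f) := by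
  ext n
  simp only [coeff_derivative, coeff_coeffDerivation, D.leibniz, smul_eq_mul]
  rw [show ((n : K) + 1) = ((n + 1 : ℕ) : K) by push_cast; rfl, D.map_natCast]
  ring

/-- If `lam` is a logarithm of the power series `Φ` and the constant terms are killed by `D`, then
`D lam` is the logarithmic derivative of `Φ`. -/
theorem mul_coeffDerivation_log {k K : Type*} [Field k] [Field K] [CharZero K] [Algebra k K]
    (D : Derivation k K K) {Φ lam : K⟦X⟧} (h : Φ * derivative K lam = derivative K Φ)
    (hΦ : constantCoeff Φ ≠ 0) (hDΦ : D (constantCoeff Φ) = 0) (hlam : D (constantCoeff lam) = 0) :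
    Φ * coeffDerivation D lam = coeffDerivation D Φ := by
  have hΦ0 : Φ ≠ 0 := by
    rintro rfl
    simp at hΦ
  -- The two derivations commute, so this difference has zero formal derivative; its constant term
  -- vanishes because `D` kills the constant terms of `Φ` and `lam`.
  set H := coeffDerivation D lam - Φ⁻¹ * coeffDerivation D Φ with hH
  have hmul : Φ * H = Φ * coeffDerivation D lam - coeffDerivation D Φ := by
    rw [hH, mul_sub, ← mul_assoc, PowerSeries.mul_inv_cancel _ hΦ, one_mul]
  suffices H = 0 by rw [this, mul_zero, eq_comm, sub_eq_zero] at hmul; exact hmul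
  have h1 := congrArg (coeffDerivation D) h
  rw [Derivation.leibniz, ← derivative_coeffDerivation, ← derivative_coeffDerivation] at h1
  have h2 := congrArg (derivative K) hmul
  rw [map_sub, Derivation.leibniz, Derivation.leibniz] at h2
  simp only [smul_eq_mul] at h1 h2
  have hd : derivative K H = 0 := by
    apply mul_left_cancel₀ (mul_ne_zero hΦ0 hΦ0)
    rw [mul_zero]
    linear_combination Φ * h2 - derivative K Φ * hmul + Φ * h1 - coeffDerivation D Φ * h
  have hc (f : K⟦X⟧) : constantCoeff (coeffDerivation D f) = D (constantCoeff f) := by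
    simpa using coeff_coeffDerivation D f 0
  refine derivative.ext (by rw [hd, map_zero]) ?_
  simp [hH, hc, hDΦ, hlam]

/-- The constants of a derivation of a field. -/
def constantsSubfield {k L : Type*} [Field k] [Field L] [Algebra k L] (D : Derivation k L L) :
    Subfield L where
  carrier := {y | D y = 0}
  mul_mem' {a b} ha hb := by
    simp only [Set.mem_ofPred_eq] at ha hb ⊢
    simp [ha, hb]
  one_mem' := D.map_one_eq_zero
  add_mem' {a b} ha hb := by
    simp only [Set.mem_ofPred_eq] at ha hb ⊢
    simp [ha, hb]
  zero_mem' := map_zero D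
  neg_mem' {a} ha := by
    simp only [Set.mem_ofPred_eq] at ha ⊢
    simp [ha]
  inv_mem' a ha := by
    simp only [Set.mem_ofPred_eq] at ha ⊢
    simp [D.leibniz_inv, ha]

/-- A derivation of a field is linear over its constants. -/
def derivationOverConstants {k L : Type*} [Field k] [Field L] [Algebra k L]
    (D : Derivation k L L) : Derivation (constantsSubfield D) L L :=
  Derivation.mk'
    { toFun := D
      map_add' := D.map_add
      map_smul' := fun c y => by
        have hc : D c = 0 := c.2
        simp [Subfield.smul_def, hc] }
    fun a b => D.leibniz a b

theorem transcendental_of_notMem_range {k K : Type*} [Field k] [IsAlgClosed k] [Field K]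
    [Algebra k K] {u : K} (hu : u ∉ Set.range (algebraMap k K)) : Transcendental k u := fun h =>
  hu (minpoly.mem_range_of_degree_eq_one k u
    (IsAlgClosed.degree_eq_one_of_irreducible k (minpoly.irreducible h.isIntegral)))

/-- The elements algebraic over `R` form an algebraically closed subalgebra of `L`, so only the
images of scalars and generators need checking. Injectivity of `φ` keeps the annihilating polynomial
nonzero. -/
theorem isAlgebraic_map_of_isAlgebraic_adjoin {k A L R : Type*} [CommRing k] [CommRing A]
    [Algebra k A] [CommRing R] [IsDomain R] [CommRing L] [IsDomain L] [Algebra R L]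
    [FaithfulSMul R L]
    {φ : A →+* L} (hφ : Function.Injective φ)
    (hk : ∀ c : k, IsAlgebraic R (φ (algebraMap k A c))) {T : Set A}
    (hT : ∀ t ∈ T, IsAlgebraic R (φ t)) {a : A} (ha : IsAlgebraic (Algebra.adjoin k T) a) :
    IsAlgebraic R (φ a) := by
  let S := Subalgebra.algebraicClosure R L
  have hS (t : Algebra.adjoin k T) : φ t ∈ S := by
    obtain ⟨t, ht⟩ := t
    induction ht using Algebra.adjoin_induction with
    | mem t ht => exact hT t ht
    | algebraMap c => exact hk c
    | add x y _ _ hx hy => simpa using add_mem hx hy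
    | mul x y _ _ hx hy => simpa using mul_mem hx hy
  let f : Algebra.adjoin k T →+* S := (φ.comp (Algebra.adjoin k T).val.toRingHom).codRestrict S hS
  have hf : Function.Injective f := fun x y hxy => Subtype.ext (hφ (congrArg Subtype.val hxy))
  exact (ha.ringHom_of_comp_eq f φ hf rfl).restrictScalars R

/-- An algebraic power series that is a linear combination of logarithms of algebraic power series
has constant coefficients. Here algebraicity is over the functions of each of the
two sets of variables. -/
theorem coeff_mem_range_of_eq_sum_log {k K : Type*} [Field k] [IsAlgClosed k] [CharZero k] [Field K]
    [Algebra k K] (s : Set K) (G : Set k⟦X⟧) {ι : Type*} [Fintype ι] (μ : ι → k)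
    (Φ₀ : K⟦X⟧) (Φ lam : ι → K⟦X⟧) (c₀ : k) (c : ι → k)
    (halg₀ : IsAlgebraic
      (Algebra.adjoin k (C '' s ∪ PowerSeries.map (algebraMap k K) '' G)) Φ₀)
    (halg : ∀ i, IsAlgebraic
      (Algebra.adjoin k (C '' s ∪ PowerSeries.map (algebraMap k K) '' G)) (Φ i))
    (hc : ∀ i, constantCoeff (Φ i) = algebraMap k K (c i)) (hc0 : ∀ i, c i ≠ 0)
    (hlog : ∀ i, Φ i * derivative K (lam i) = derivative K (Φ i))
    (hlam : ∀ i, constantCoeff (lam i) = 0)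
    (h : Φ₀ = algebraMap k K⟦X⟧ c₀ + ∑ i, μ i • lam i) (n : ℕ) :
    coeff n Φ₀ ∈ Set.range (algebraMap k K) := by
  by_contra hn
  set u := coeff n Φ₀ with hu
  have : CharZero K := charZero_of_injective_algebraMap (algebraMap k K).injective
  obtain ⟨B, huB, -, hB, hs⟩ := exists_algebraicIndepOn_insert (transcendental_of_notMem_range hn) s
  obtain ⟨D, hDu, hDB⟩ := exists_derivation_of_algebraicIndepOn hB huB
  let L := FractionRing K⟦X⟧
  let ε : K⟦X⟧ →ₐ[k] L := IsScalarTower.toAlgHom k K⟦X⟧ L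
  have hε : Function.Injective ε := IsFractionRing.injective K⟦X⟧ L
  have : Algebra.FormallyEtale K⟦X⟧ L := .of_isLocalization (nonZeroDivisors K⟦X⟧)
  obtain ⟨Δ, hΔ⟩ := exists_derivation_extending (R := k) (S := K⟦X⟧) (T := L)
    ((Algebra.linearMap K⟦X⟧ L).compDer (coeffDerivation D))
  have hΔ (f : K⟦X⟧) : Δ (ε f) = ε (coeffDerivation D f) := hΔ f
  have hΔC (f : K) : Δ (ε (C f)) = ε (C (D f)) := by
    rw [hΔ]
    congr 1
    ext m
    simp only [coeff_coeffDerivation, coeff_C]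
    split_ifs <;> simp
  -- The constants contain `k`, the basis elements other than `u`, and all series with coefficients
  -- in `k`. Hence both sets of variables are algebraic over `Cst[u]`.
  let Cst := constantsSubfield Δ
  have : CharZero L := charZero_of_injective_algebraMap (algebraMap k L).injective
  have : CharZero Cst := (algebraMap Cst L).charZero
  let R := Algebra.adjoin Cst {ε (C u)}
  have hconst {y : L} (hy : Δ y = 0) : y ∈ R := R.algebraMap_mem (⟨y, hy⟩ : Cst)
  have hk (a : k) : algebraMap k L a ∈ R := hconst (Δ.map_algebraMap a)
  have hRk (a : k) : IsAlgebraic R (algebraMap k L a) := isAlgebraic_algebraMap (⟨_, hk a⟩ : R)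
  have hRC {f : K} (hf : f ∈ s) : IsAlgebraic R (ε (C f)) := by
    refine isAlgebraic_map_of_isAlgebraic_adjoin (φ := ε.toRingHom.comp C)
      (hε.comp C_injective) (fun a => ?_) (fun b hb => ?_) (hs f hf)
    · have h1 : ε (C (algebraMap k K a)) = algebraMap k L a := by
        rw [← PowerSeries.algebraMap_apply, ε.commutes]
      exact h1 ▸ hRk a
    · by_cases hbu : b = u
      · exact isAlgebraic_algebraMap (⟨ε (C b), hbu ▸ Algebra.subset_adjoin rfl⟩ : R)
      · exact isAlgebraic_algebraMap (⟨ε (C b), hconst (by simp [hΔC, hDB b hb hbu])⟩ : R)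
  have hRG (g : k⟦X⟧) : IsAlgebraic R (ε (PowerSeries.map (algebraMap k K) g)) := by
    have h0 : coeffDerivation D (PowerSeries.map (algebraMap k K) g) = 0 := by
      ext m
      simp [coeff_coeffDerivation]
    have h1 : Δ (ε (PowerSeries.map (algebraMap k K) g)) = 0 := by rw [hΔ, h0, map_zero]
    exact isAlgebraic_algebraMap (⟨ε (PowerSeries.map (algebraMap k K) g), hconst h1⟩ : R)
  have hR {f : K⟦X⟧} (hf : IsAlgebraic
      (Algebra.adjoin k (C '' s ∪ PowerSeries.map (algebraMap k K) '' G)) f) :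
      IsAlgebraic R (ε f) := by
    refine isAlgebraic_map_of_isAlgebraic_adjoin (φ := ε.toRingHom) hε (fun a => ?_) ?_ hf
    · simpa using hRk a
    · rintro _ (⟨f, hf, rfl⟩ | ⟨g, -, rfl⟩)
      exacts [hRC hf, hRG g]
  have hΦne (i : ι) : Φ i ≠ 0 := fun h0 => hc0 i (by simpa [h0] using (hc i).symm)
  have hεne (i : ι) : ε (Φ i) ≠ 0 := fun h0 => hΦne i (hε (by simpa using h0))
  have hlogD (i : ι) : Φ i * coeffDerivation D (lam i) = coeffDerivation D (Φ i) :=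
    mul_coeffDerivation_log D (hlog i) (by simpa [hc] using hc0 i) (by simp [hc])
      (by simp [hlam])
  have key := derivation_eq_zero_of_eq_sum_logDeriv (derivationOverConstants Δ) (y₀ := ε Φ₀)
    (fun i => (⟨algebraMap k L (μ i), Δ.map_algebraMap _⟩ : Cst)) (fun i => ε (Φ i)) hεne
    (hR halg₀) (fun i => hR (halg i)) (by
      change Δ _ = ∑ i, algebraMap k L (μ i) * (Δ _ / _)
      rw [hΔ, h, map_add, Derivation.map_algebraMap, zero_add, map_sum, map_sum]
      refine Finset.sum_congr rfl fun i _ => ?_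
      rw [hΔ, ← hlogD, map_mul, mul_div_cancel_left₀ _ (hεne i), Derivation.map_smul, map_smul,
        Algebra.smul_def])
  change Δ _ = 0 at key
  rw [hΔ, ← map_zero ε] at key
  -- The coefficient of degree `n` is `D u = 1`, yet it must vanish.
  have := congrArg (coeff n) (hε key)
  rw [coeff_coeffDerivation, ← hu, hDu, map_zero] at this
  exact one_ne_zero this

/-! ### Homomorphisms on germs and formal Taylor series -/

/-- A ring homomorphism over `ℂ` from the germs of holomorphic functions at `0 ∈ E` to `A`. -/
structure GermHom (E A : Type*) [NormedAddCommGroup E] [NormedSpace ℂ E] [CommRing A]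
    [Algebra ℂ A] where
  toFun : (E → ℂ) → A
  congr' : ∀ {f g : E → ℂ}, f =ᶠ[𝓝 0] g → toFun f = toFun g
  map_const : ∀ c : ℂ, toFun (fun _ => c) = algebraMap ℂ A c
  map_add : ∀ {f g : E → ℂ}, AnalyticAt ℂ f 0 → AnalyticAt ℂ g 0 →
    toFun (fun x => f x + g x) = toFun f + toFun g
  map_mul : ∀ {f g : E → ℂ}, AnalyticAt ℂ f 0 → AnalyticAt ℂ g 0 →
    toFun (fun x => f x * g x) = toFun f * toFun g

/-- The derivative in a fixed direction. -/
noncomputable def dirDeriv {E : Type*} [NormedAddCommGroup E] [NormedSpace ℂ E] (v : E)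
    (f : E → ℂ) : E → ℂ := fun x => fderiv ℂ f x v

section DirDeriv

variable {E : Type*} [NormedAddCommGroup E] [NormedSpace ℂ E] {v x : E} {f g : E → ℂ}

theorem analyticAt_dirDeriv (hf : AnalyticAt ℂ f x) : AnalyticAt ℂ (dirDeriv v f) x :=
  ((ContinuousLinearMap.apply ℂ ℂ v).analyticAt _).comp hf.fderiv

theorem dirDeriv_congr (h : f =ᶠ[𝓝 x] g) : dirDeriv v f =ᶠ[𝓝 x] dirDeriv v g :=
  (h.fderiv (𝕜 := ℂ)).mono fun _ hy => congrArg (fun l : E →L[ℂ] ℂ => l v) hy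

theorem dirDeriv_add (hf : AnalyticAt ℂ f x) (hg : AnalyticAt ℂ g x) :
    dirDeriv v (fun y => f y + g y) =ᶠ[𝓝 x] fun y => dirDeriv v f y + dirDeriv v g y := by
  filter_upwards [hf.eventually_analyticAt, hg.eventually_analyticAt] with y hfy hgy
  simp [dirDeriv, fderiv_fun_add hfy.differentiableAt hgy.differentiableAt]

theorem dirDeriv_mul (hf : AnalyticAt ℂ f x) (hg : AnalyticAt ℂ g x) :
    dirDeriv v (fun y => f y * g y) =ᶠ[𝓝 x]
      fun y => f y * dirDeriv v g y + g y * dirDeriv v f y := by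
  filter_upwards [hf.eventually_analyticAt, hg.eventually_analyticAt] with y hfy hgy
  simp [dirDeriv, fderiv_fun_mul hfy.differentiableAt hgy.differentiableAt]

theorem dirDeriv_const (c : ℂ) : dirDeriv v (fun _ => c) = fun _ => 0 := by
  ext
  simp [dirDeriv]

theorem dirDeriv_comp {F : Type*} [NormedAddCommGroup F] [NormedSpace ℂ F] (l : E →L[ℂ] F)
    {f : F → ℂ} (hf : AnalyticAt ℂ f (l x)) :
    dirDeriv v (fun y => f (l y)) =ᶠ[𝓝 x] fun y => dirDeriv (l v) f (l y) := by
  filter_upwards [l.continuous.continuousAt.eventually hf.eventually_analyticAt] with y hy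
  have := (hy.differentiableAt.hasFDerivAt.comp y l.hasFDerivAt).fderiv
  simp only [Function.comp_def] at this
  simp [dirDeriv, this]

theorem analyticAt_dirDeriv_iterate (hf : AnalyticAt ℂ f x) (n : ℕ) :
    AnalyticAt ℂ ((dirDeriv v)^[n] f) x := by
  induction n with
  | zero => exact hf
  | succ n ih =>
    rw [Function.iterate_succ_apply']
    exact analyticAt_dirDeriv ih

end DirDeriv

namespace GermHom

variable {E F A B : Type*} [NormedAddCommGroup E] [NormedSpace ℂ E] [NormedAddCommGroup F]
  [NormedSpace ℂ F] [CommRing A] [Algebra ℂ A] [CommRing B] [Algebra ℂ B]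

instance : CoeFun (GermHom E A) fun _ => (E → ℂ) → A := ⟨toFun⟩

theorem map_zero (T : GermHom E A) : T (fun _ => 0) = 0 := by simpa using T.map_const 0

theorem eval_mvPolynomial (T : GermHom E A) {ι : Type*} (h : ι → E → ℂ)
    (hh : ∀ i, AnalyticAt ℂ (h i) 0) (P : MvPolynomial ι ℂ) :
    AnalyticAt ℂ (fun x => MvPolynomial.eval (fun i => h i x) P) 0 ∧
      T (fun x => MvPolynomial.eval (fun i => h i x) P) = MvPolynomial.aeval (fun i => T (h i)) P := by
  induction P using MvPolynomial.induction_on with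
  | C a => simpa using ⟨analyticAt_const, T.map_const a⟩
  | add p q hp hq =>
    simp only [_root_.map_add]
    exact ⟨hp.1.add hq.1, by rw [T.map_add hp.1 hq.1, hp.2, hq.2]⟩
  | mul_X p i hp =>
    simp only [_root_.map_mul, MvPolynomial.eval_X, MvPolynomial.aeval_X]
    exact ⟨hp.1.mul (hh i), by rw [T.map_mul hp.1 (hh i), hp.2]⟩

/-- Evaluation at the origin. -/
def evalZero (E : Type*) [NormedAddCommGroup E] [NormedSpace ℂ E] : GermHom E ℂ where
  toFun f := f 0
  congr' h := h.self_of_nhds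
  map_const _ := rfl
  map_add _ _ := rfl
  map_mul _ _ := rfl

/-- Composition with the pull-back along a linear map. -/
def pullback (T : GermHom E A) (l : E →L[ℂ] F) : GermHom F A where
  toFun f := T fun x => f (l x)
  congr' h := T.congr' ((l.continuous.tendsto' 0 0 l.map_zero).eventually h)
  map_const c := T.map_const c
  map_add {f g} hf hg := T.map_add
    ((l.map_zero.symm ▸ hf : AnalyticAt ℂ f (l 0)).comp (l.analyticAt 0))
    ((l.map_zero.symm ▸ hg : AnalyticAt ℂ g (l 0)).comp (l.analyticAt 0))
  map_mul {f g} hf hg := T.map_mul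
    ((l.map_zero.symm ▸ hf : AnalyticAt ℂ f (l 0)).comp (l.analyticAt 0))
    ((l.map_zero.symm ▸ hg : AnalyticAt ℂ g (l 0)).comp (l.analyticAt 0))

section Taylor

/-- The formal Taylor series in the direction `v`, with coefficients mapped by `T`. -/
noncomputable def taylorFun (T : GermHom E A) (v : E) (f : E → ℂ) : A⟦X⟧ :=
  PowerSeries.mk fun n => ((n.factorial : ℂ)⁻¹) • T ((dirDeriv v)^[n] f)

theorem coeff_taylorFun (T : GermHom E A) (v : E) (f : E → ℂ) (n : ℕ) :
    coeff n (T.taylorFun v f) = ((n.factorial : ℂ)⁻¹) • T ((dirDeriv v)^[n] f) := coeff_mk _ _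

theorem coeff_zero_taylorFun (T : GermHom E A) (v : E) (f : E → ℂ) :
    coeff 0 (T.taylorFun v f) = T f := by
  simp [coeff_taylorFun]

theorem constantCoeff_taylorFun (T : GermHom E A) (v : E) (f : E → ℂ) :
    constantCoeff (T.taylorFun v f) = T f := by
  rw [← coeff_zero_taylorFun T v f, coeff_zero_eq_constantCoeff_apply]

/-- This recursion lets identities between Taylor series be proved by induction on the degree, with
the functions varying; products then need only the first-order Leibniz rule. -/
theorem coeff_succ_taylorFun (T : GermHom E A) (v : E) (f : E → ℂ) (n : ℕ) :
    coeff (n + 1) (T.taylorFun v f) =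
      ((n + 1 : ℂ)⁻¹) • coeff n (T.taylorFun v (dirDeriv v f)) := by
  rw [coeff_taylorFun, coeff_taylorFun, Function.iterate_succ_apply, smul_smul,
    Nat.factorial_succ]
  push_cast
  rw [mul_inv]

theorem derivative_taylorFun (T : GermHom E A) (v : E) (f : E → ℂ) :
    derivative A (T.taylorFun v f) = T.taylorFun v (dirDeriv v f) := by
  ext n
  rw [coeff_derivative, coeff_succ_taylorFun,
    show ((n : A) + 1) = algebraMap ℂ A (n + 1) by simp, mul_comm, ← Algebra.smul_def, smul_smul,
    mul_inv_cancel₀ (Nat.cast_add_one_ne_zero n), one_smul]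

theorem coeff_succ_eq_smul (f : A⟦X⟧) (n : ℕ) :
    coeff (n + 1) f = ((n + 1 : ℂ)⁻¹) • coeff n (derivative A f) := by
  rw [coeff_derivative, show ((n : A) + 1) = algebraMap ℂ A (n + 1) by simp, mul_comm,
    ← Algebra.smul_def, smul_smul, inv_mul_cancel₀ (Nat.cast_add_one_ne_zero n), one_smul]

theorem taylorFun_congr (T : GermHom E A) (v : E) {f g : E → ℂ} (h : f =ᶠ[𝓝 0] g) :
    T.taylorFun v f = T.taylorFun v g := by
  ext n
  induction n generalizing f g with
  | zero => rw [coeff_zero_taylorFun, coeff_zero_taylorFun, T.congr' h]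
  | succ n ih => rw [coeff_succ_taylorFun, coeff_succ_taylorFun, ih (dirDeriv_congr h)]

theorem taylorFun_add (T : GermHom E A) (v : E) {f g : E → ℂ} (hf : AnalyticAt ℂ f 0)
    (hg : AnalyticAt ℂ g 0) :
    T.taylorFun v (fun x => f x + g x) = T.taylorFun v f + T.taylorFun v g := by
  ext n
  induction n generalizing f g with
  | zero => simp only [coeff_zero_taylorFun, T.map_add hf hg, _root_.map_add]
  | succ n ih =>
    rw [_root_.map_add]
    simp only [coeff_succ_taylorFun]
    rw [taylorFun_congr T v (dirDeriv_add hf hg),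
      ih (analyticAt_dirDeriv hf) (analyticAt_dirDeriv hg), _root_.map_add, smul_add]

theorem taylorFun_mul (T : GermHom E A) (v : E) {f g : E → ℂ} (hf : AnalyticAt ℂ f 0)
    (hg : AnalyticAt ℂ g 0) :
    T.taylorFun v (fun x => f x * g x) = T.taylorFun v f * T.taylorFun v g := by
  ext n
  induction n generalizing f g with
  | zero => simp [coeff_zero_taylorFun, T.map_mul hf hg, constantCoeff_taylorFun]
  | succ n ih =>
    have hf' := analyticAt_dirDeriv (v := v) hf
    have hg' := analyticAt_dirDeriv (v := v) hg
    rw [coeff_succ_taylorFun, coeff_succ_eq_smul, taylorFun_congr T v (dirDeriv_mul hf hg),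
      taylorFun_add T v (hf.fun_mul hg') (hg.fun_mul hf'), Derivation.leibniz, _root_.map_add,
      _root_.map_add, ih hf hg', ih hg hf', derivative_taylorFun, derivative_taylorFun,
      smul_eq_mul, smul_eq_mul]

theorem taylorFun_const (T : GermHom E A) (v : E) (c : ℂ) :
    T.taylorFun v (fun _ => c) = algebraMap ℂ A⟦X⟧ c := by
  have h0 (n : ℕ) : coeff n (T.taylorFun v (fun _ => 0)) = 0 := by
    induction n with
    | zero => rw [coeff_zero_taylorFun, T.map_zero]
    | succ n ih => rw [coeff_succ_taylorFun, dirDeriv_const, ih, smul_zero]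
  ext n
  rw [PowerSeries.algebraMap_apply, coeff_C]
  cases n with
  | zero => rw [coeff_zero_taylorFun, T.map_const, if_pos rfl]
  | succ n =>
    rw [coeff_succ_taylorFun, dirDeriv_const, h0, smul_zero, if_neg (Nat.succ_ne_zero n)]

/-- The formal Taylor series in the direction `v`, with coefficients mapped by `T`. -/
noncomputable def taylor (T : GermHom E A) (v : E) : GermHom E A⟦X⟧ where
  toFun := T.taylorFun v
  congr' := T.taylorFun_congr v
  map_const := T.taylorFun_const v
  map_add := T.taylorFun_add v
  map_mul := T.taylorFun_mul v

theorem constantCoeff_taylor (T : GermHom E A) (v : E) (f : E → ℂ) :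
    constantCoeff (T.taylor v f) = T f := T.constantCoeff_taylorFun v f

theorem derivative_taylor (T : GermHom E A) (v : E) (f : E → ℂ) :
    derivative A (T.taylor v f) = T.taylor v (dirDeriv v f) := T.derivative_taylorFun v f

theorem coeff_zero_taylor (T : GermHom E A) (v : E) (f : E → ℂ) :
    coeff 0 (T.taylor v f) = T f := T.coeff_zero_taylorFun v f

theorem coeff_succ_taylor (T : GermHom E A) (v : E) (f : E → ℂ) (n : ℕ) :
    coeff (n + 1) (T.taylor v f) = ((n + 1 : ℂ)⁻¹) • coeff n (T.taylor v (dirDeriv v f)) :=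
  T.coeff_succ_taylorFun v f n

theorem taylor_of_dirDeriv_eq_zero (T : GermHom E A) {v : E} {f : E → ℂ}
    (h : dirDeriv v f =ᶠ[𝓝 0] fun _ => 0) : T.taylor v f = C (T f) := by
  ext n
  rw [coeff_C]
  cases n with
  | zero => rw [coeff_zero_taylor, if_pos rfl]
  | succ n =>
    rw [coeff_succ_taylor, (T.taylor v).congr' h, (T.taylor v).map_zero, _root_.map_zero,
      smul_zero, if_neg (Nat.succ_ne_zero n)]

theorem taylor_of_dirDeriv_eq_one (T : GermHom E A) {v : E} {f : E → ℂ}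
    (h : dirDeriv v f =ᶠ[𝓝 0] fun _ => 1) : T.taylor v f = C (T f) + X := by
  ext n
  rw [_root_.map_add, coeff_C, coeff_X]
  cases n with
  | zero => simp [coeff_zero_taylor]
  | succ n =>
    rw [coeff_succ_taylor, (T.taylor v).congr' h, (T.taylor v).map_const,
      PowerSeries.algebraMap_apply, coeff_C]
    by_cases hn : n = 0 <;> simp [hn]

end Taylor

end GermHom

end

/-! ### Algebraicity of Nash functions after substitution -/

theorem ringHom_aeval {R A B σ : Type*} [CommRing R] [CommRing A] [CommRing B] [Algebra R A]
    [Algebra R B] (φ : A →+* B) (hφ : ∀ r, φ (algebraMap R A r) = algebraMap R B r) (q : σ → A)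
    (P : MvPolynomial σ R) :
    φ (MvPolynomial.aeval q P) = MvPolynomial.aeval (fun i => φ (q i)) P :=
  MvPolynomial.comp_aeval_apply (φ := ({ φ with commutes' := hφ } : A →ₐ[R] B)) q P

/-- A Nash algebraic function of holomorphic functions is algebraic over these functions, even
when they are algebraically dependent. -/
theorem isAlgebraic_of_isNashAt {E B : Type*} [NormedAddCommGroup E] [NormedSpace ℂ E]
    [CommRing B] [IsDomain B] [Algebra ℂ B] (T : GermHom E B) (η : B →ₐ[ℂ] ℂ)
    (hη : ∀ f, AnalyticAt ℂ f 0 → η (T f) = f 0) {ι : Type} [Fintype ι] {g : (ι → ℂ) → ℂ}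
    {h : ι → E → ℂ} (hh : ∀ i, AnalyticAt ℂ (h i) 0) (hg : IsNashAt g fun i => h i 0) :
    IsAlgebraic (Algebra.adjoin ℂ (Set.range fun i => T (h i))) (T fun z => g fun i => h i z) := by
  obtain ⟨hga, P, hP0, hP⟩ := hg
  -- Substituting dependent `h i` may turn `P` into the zero polynomial. A point `y` off its zero
  -- set gives a direction `v` such that the deformation `h i + v i * t` avoids this: over the
  -- origin it reaches `y` at `t = 1`.
  obtain ⟨y, hy⟩ : ∃ y, MvPolynomial.eval y P ≠ 0 := by
    by_contra! hall
    exact hP0 (MvPolynomial.funext fun y => by simpa using hall y)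
  let v (i : ι) : ℂ := y (some i) - h i 0
  let T₁ := (T.pullback (ContinuousLinearMap.inl ℂ E ℂ)).taylor ((0, 1) : E × ℂ)
  let Hs (i : ι) (p : E × ℂ) : ℂ := h i p.1 + v i * p.2
  have hfst (i : ι) : AnalyticAt ℂ (fun p : E × ℂ => h i p.1) 0 :=
    (hh i).comp_of_eq (analyticAt_fst) rfl
  have hsnd : AnalyticAt ℂ (fun p : E × ℂ => p.2) 0 := analyticAt_snd
  have hHs (i : ι) : AnalyticAt ℂ (Hs i) 0 := (hfst i).fun_add (analyticAt_const.fun_mul hsnd)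
  have hHt : Tendsto (fun p i => Hs i p) (𝓝 (0 : E × ℂ)) (𝓝 fun i => h i 0) :=
    tendsto_pi_nhds.mpr fun i => by simpa [Hs] using (hHs i).continuousAt.tendsto
  let Hn (p : E × ℂ) : ℂ := g fun i => Hs i p
  have hHn : AnalyticAt ℂ Hn 0 := by
    refine AnalyticAt.comp_of_eq (g := g) (f := fun p i => Hs i p) hga ?_ (by simp [Hs])
    exact AnalyticAt.pi hHs
  let H (o : Option ι) : E × ℂ → ℂ := o.elim Hn Hs
  have hH (o : Option ι) : AnalyticAt ℂ (H o) 0 := by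
    cases o
    exacts [hHn, hHs _]
  have hT₁s (i : ι) : T₁ (Hs i) =
      PowerSeries.C (T (h i)) + algebraMap ℂ (PowerSeries B) (v i) * PowerSeries.X := by
    have h1 : T₁ (fun p => h i p.1) = PowerSeries.C (T (h i)) := by
      refine GermHom.taylor_of_dirDeriv_eq_zero _ ?_
      refine (dirDeriv_comp (ContinuousLinearMap.fst ℂ E ℂ) (hh i)).trans
        (Eventually.of_forall fun p => ?_)
      simp [dirDeriv]
    have h2 : T₁ (fun p => p.2) = PowerSeries.X := by
      have h3 : dirDeriv ((0, 1) : E × ℂ) (fun p : E × ℂ => p.2) = fun _ => 1 := by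
        ext p
        have : fderiv ℂ (fun p : E × ℂ => p.2) p = ContinuousLinearMap.snd ℂ E ℂ :=
          (ContinuousLinearMap.snd ℂ E ℂ).fderiv
        simp [dirDeriv, this]
      have h4 := GermHom.taylor_of_dirDeriv_eq_one (T.pullback (ContinuousLinearMap.inl ℂ E ℂ))
        (v := ((0, 1) : E × ℂ)) (f := fun p => p.2) (Eventually.of_forall (congrFun h3))
      have h5 : T.pullback (ContinuousLinearMap.inl ℂ E ℂ) (fun p => p.2) = 0 := T.map_zero
      rwa [h5, map_zero, zero_add] at h4
    rw [T₁.map_add (hfst i) (analyticAt_const.fun_mul hsnd), T₁.map_mul analyticAt_const hsnd,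
      T₁.map_const, h1, h2]
  have hT₁n : PowerSeries.constantCoeff (T₁ Hn) = T fun z => g fun i => h i z := by
    rw [GermHom.constantCoeff_taylor]
    change T (fun z => g fun i => h i z + v i * 0) = _
    simp
  let S := Algebra.adjoin ℂ (Set.range fun i => T (h i))
  let b (i : ι) : S := ⟨T (h i), Algebra.subset_adjoin ⟨i, rfl⟩⟩
  -- The outer polynomial variable is `t`, the inner one the value of `g`. Below, `φ` substitutes
  -- the actual Taylor series in `t` and kills `Q`, while `χ` specializes to the point `y` and shows
  -- `Q ≠ 0`.
  let q (o : Option ι) : Polynomial (Polynomial S) := o.elim (Polynomial.C Polynomial.X)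
    fun i => Polynomial.C (Polynomial.C (b i)) + algebraMap ℂ _ (v i) * Polynomial.X
  let Q := MvPolynomial.aeval q P
  let φ : Polynomial (Polynomial S) →+* PowerSeries B := Polynomial.eval₂RingHom
    (Polynomial.eval₂RingHom (PowerSeries.C.comp S.val.toRingHom) (T₁ Hn)) PowerSeries.X
  let χ : Polynomial (Polynomial S) →+* ℂ := Polynomial.eval₂RingHom
    (Polynomial.eval₂RingHom (η.toRingHom.comp S.val.toRingHom) (y none)) 1
  have hφc (a : ℂ) : φ (algebraMap ℂ _ a) = algebraMap ℂ _ a := by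
    rw [Polynomial.algebraMap_apply, Polynomial.algebraMap_apply]
    simp [φ, PowerSeries.algebraMap_apply]
  have hχc (a : ℂ) : χ (algebraMap ℂ _ a) = a := by
    rw [Polynomial.algebraMap_apply, Polynomial.algebraMap_apply]
    simp [χ]
  have hφQ : φ Q = 0 := by
    have h1 := (T₁.eval_mvPolynomial H hH P).2
    have h2 : (fun p => MvPolynomial.eval (fun o => H o p) P) =ᶠ[𝓝 0] fun _ => 0 := by
      filter_upwards [hHt.eventually hP] with p hp
      rw [← hp]
      congr 2
      ext o
      cases o <;> rfl
    rw [T₁.congr' h2, T₁.map_zero] at h1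
    rw [h1]
    refine (ringHom_aeval φ hφc q P).trans ?_
    congr 2
    · ext1 o
      cases o with
      | none => simp [q, φ, H]
      | some i =>
        simp only [q, Option.elim_some, map_add, map_mul, hφc, H, hT₁s]
        simp [φ, b]
  have hχQ : χ Q ≠ 0 := by
    convert hy
    refine (ringHom_aeval χ hχc q P).trans ?_
    rw [MvPolynomial.aeval_eq_eval]
    congr 2
    · ext1 o
      cases o with
      | none => simp [q, χ]
      | some i =>
        simp only [q, Option.elim_some, map_add, map_mul, hχc]
        simp [χ, b, v, hη _ (hh i)]
  have hQ : Q ≠ 0 := fun h0 => hχQ (by rw [h0, map_zero])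
  -- Removing the power of `t` dividing `Q` makes the specialization `t = 0` a nonzero polynomial,
  -- which still annihilates the undeformed function.
  obtain ⟨Q₁, hQ₁, hdvd⟩ := Polynomial.exists_eq_pow_rootMultiplicity_mul_and_not_dvd Q hQ 0
  rw [Polynomial.C_0, sub_zero] at hQ₁ hdvd
  rw [Polynomial.X_dvd_iff] at hdvd
  have hφQ₁ : φ Q₁ = 0 := by
    rw [hQ₁, map_mul, map_pow] at hφQ
    refine (mul_eq_zero.mp hφQ).resolve_left (pow_ne_zero _ ?_)
    simp [φ, PowerSeries.X_ne_zero]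
  refine ⟨Q₁.coeff 0, hdvd, ?_⟩
  have hcomp : PowerSeries.constantCoeff.comp φ =
      ((Polynomial.aeval (T fun z => g fun i => h i z)).toRingHom :
        Polynomial S →+* B).comp Polynomial.constantCoeff := by
    refine Polynomial.ringHom_ext' (Polynomial.ringHom_ext' ?_ ?_) ?_
    · ext a
      simp [φ]
    · simp [φ, hT₁n]
    · simp [φ]
  have := congrArg PowerSeries.constantCoeff hφQ₁
  rw [map_zero] at this
  rw [← this]
  exact (congrArg (fun f : Polynomial (Polynomial S) →+* B => f Q₁) hcomp).symm

/-! ### Uniqueness of polarisation and the diastasis condition -/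

theorem eqOn_zero_of_real {f : ℂ → ℂ} {r : ℝ} (hr : 0 < r)
    (hf : DifferentiableOn ℂ f (Metric.ball 0 r)) (h0 : ∀ x : ℝ, |x| < r → f x = 0) :
    Set.EqOn f 0 (Metric.ball 0 r) := by
  refine (hf.analyticOnNhd Metric.isOpen_ball).eqOn_zero_of_preconnected_of_frequently_eq_zero
    (convex_ball 0 r).isPreconnected (Metric.mem_ball_self hr) ?_
  have ht : Tendsto (fun x : ℝ => (x : ℂ)) (𝓝[≠] 0) (𝓝[≠] 0) :=
    tendsto_nhdsWithin_iff.mpr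
      ⟨(Complex.continuous_ofReal.tendsto' 0 0 Complex.ofReal_zero).mono_left nhdsWithin_le_nhds,
        eventually_mem_nhdsWithin.mono fun x hx => by simpa using hx⟩
  refine ht.frequently (Eventually.frequently ?_)
  have : ∀ᶠ x : ℝ in 𝓝 0, |x| < r := by
    filter_upwards [Metric.ball_mem_nhds (0 : ℝ) hr] with x hx
    simpa using hx
  exact (this.filter_mono nhdsWithin_le_nhds).mono fun x hx => h0 x hx

/-- `F` is holomorphic on complex lines. -/
def LineDifferentiableOn (F : ℂ × ℂ → ℂ) (r : ℝ) : Prop :=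
  ∀ p v : ℂ × ℂ, DifferentiableOn ℂ (fun t : ℂ => F (p + t • v))
    {t | p + t • v ∈ Metric.ball (0 : ℂ × ℂ) r}

/-- A holomorphic function of `(z, w)` which vanishes for `w = z̄` vanishes identically. -/
theorem eventuallyEq_zero_of_conj {F : ℂ × ℂ → ℂ} {r : ℝ} (hr : 0 < r)
    (hF : LineDifferentiableOn F r) (h : ∀ᶠ z in 𝓝 (0 : ℂ), F (z, starRingEnd ℂ z) = 0) :
    F =ᶠ[𝓝 0] fun _ => 0 := by
  obtain ⟨δ, hδ, hball⟩ := Metric.eventually_nhds_iff_ball.mp h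
  -- With `z = x + iy` and `w = x - iy`, the set `w = z̄` is the real plane, so the one-variable
  -- identity theorem applies first in `x`, then in `y`. Halving keeps `|x| + |y|` below `r` and
  -- `δ`.
  set ρ := min r δ / 2 with hρ
  have hρ0 : 0 < ρ := by positivity
  have hρr : 2 * ρ ≤ r := by rw [hρ]; linarith [min_le_left r δ]
  have hρδ : 2 * ρ ≤ δ := by rw [hρ]; linarith [min_le_right r δ]
  have hmem {x y : ℂ} (hx : ‖x‖ < ρ) (hy : ‖y‖ < ρ) :
      (x + y * Complex.I, x - y * Complex.I) ∈ Metric.ball (0 : ℂ × ℂ) r := by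
    rw [mem_ball_zero_iff, Prod.norm_def, max_lt_iff]
    have hI : ‖y * Complex.I‖ = ‖y‖ := by simp
    exact ⟨(norm_add_le _ _).trans_lt (by rw [hI]; linarith),
      (norm_sub_le _ _).trans_lt (by rw [hI]; linarith)⟩
  have hx (y : ℂ) (hy : ‖y‖ < ρ) : DifferentiableOn ℂ
      (fun x => F (x + y * Complex.I, x - y * Complex.I)) (Metric.ball 0 ρ) := by
    have h1 (x : ℂ) : (y * Complex.I, -(y * Complex.I)) + x • ((1, 1) : ℂ × ℂ) =
        (x + y * Complex.I, x - y * Complex.I) := by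
      ext <;> simp <;> ring
    have h2 := hF (y * Complex.I, -(y * Complex.I)) (1, 1)
    simp only [h1] at h2
    exact h2.mono fun x hx => hmem (by simpa using hx) hy
  have hy (x : ℂ) (hx : ‖x‖ < ρ) : DifferentiableOn ℂ
      (fun y => F (x + y * Complex.I, x - y * Complex.I)) (Metric.ball 0 ρ) := by
    have h1 (y : ℂ) : (x, x) + y • ((Complex.I, -Complex.I) : ℂ × ℂ) =
        (x + y * Complex.I, x - y * Complex.I) := by
      ext <;> simp [sub_eq_add_neg]
    have h2 := hF (x, x) (Complex.I, -Complex.I)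
    simp only [h1] at h2
    exact h2.mono fun y hy => hmem hx (by simpa using hy)
  have hreal (x y : ℝ) (hx : |x| < ρ) (hy : |y| < ρ) :
      F (x + y * Complex.I, x - y * Complex.I) = 0 := by
    have h1 := hball (x + y * Complex.I) (by
      rw [mem_ball_zero_iff]
      refine (norm_add_le _ _).trans_lt ?_
      simp only [Complex.norm_real, norm_mul, Complex.norm_I, mul_one, Real.norm_eq_abs]
      linarith)
    simpa [sub_eq_add_neg] using h1
  have hxreal (y : ℝ) (hy' : |y| < ρ) (x : ℂ) (hx' : ‖x‖ < ρ) :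
      F (x + y * Complex.I, x - y * Complex.I) = 0 :=
    eqOn_zero_of_real hρ0 (hx y (by simpa using hy')) (fun x hx => hreal x y hx hy')
      (by simpa using hx')
  have hall (x y : ℂ) (hx' : ‖x‖ < ρ) (hy' : ‖y‖ < ρ) :
      F (x + y * Complex.I, x - y * Complex.I) = 0 :=
    eqOn_zero_of_real hρ0 (hy x hx') (fun y hy => hxreal y hy x hx') (by simpa using hy')
  filter_upwards [Metric.ball_mem_nhds (0 : ℂ × ℂ) hρ0] with p hp
  rw [mem_ball_zero_iff, Prod.norm_def, max_lt_iff] at hp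
  have h1 := hall ((p.1 + p.2) / 2) ((p.1 - p.2) / (2 * Complex.I))
    (by
      rw [norm_div]
      have := norm_add_le p.1 p.2
      norm_num
      linarith)
    (by
      rw [norm_div]
      have := norm_sub_le p.1 p.2
      norm_num
      linarith)
  have h2 : (p.1 - p.2) / (2 * Complex.I) * Complex.I = (p.1 - p.2) / 2 := by
    field_simp
  rw [h2] at h1
  convert h1 using 2
  ext <;> simp <;> ring

theorem exists_lineDifferentiableOn_of_analyticAt {F : ℂ × ℂ → ℂ} (hF : AnalyticAt ℂ F 0) :
    ∃ r > 0, LineDifferentiableOn F r := by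
  obtain ⟨r, hr, hball⟩ := Metric.eventually_nhds_iff_ball.mp hF.eventually_analyticAt
  refine ⟨r, hr, fun p v t ht => ?_⟩
  have h1 : DifferentiableAt ℂ F (p + t • v) := (hball _ ht).differentiableAt
  exact (DifferentiableAt.comp (g := F) (f := fun t : ℂ => p + t • v) t h1
    (by fun_prop)).differentiableWithinAt

theorem eventuallyEq_zero_of_analyticAt_of_conj {F : ℂ × ℂ → ℂ} (hF : AnalyticAt ℂ F 0)
    (h : ∀ᶠ z in 𝓝 (0 : ℂ), F (z, starRingEnd ℂ z) = 0) : F =ᶠ[𝓝 0] fun _ => 0 := by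
  obtain ⟨r, hr, hline⟩ := exists_lineDifferentiableOn_of_analyticAt hF
  exact eventuallyEq_zero_of_conj hr hline h

theorem LineDifferentiableOn.mono {F : ℂ × ℂ → ℂ} {r s : ℝ} (h : LineDifferentiableOn F r)
    (hs : s ≤ r) : LineDifferentiableOn F s := fun p v =>
  (h p v).mono fun _ ht => Metric.ball_subset_ball hs ht

/-- The polarisation of a function of diastasis-type is constant on the coordinate axes. -/
theorem IsDiastasisType.eventually_eq_const {ψ : ℂ → ℝ} (hψ : IsDiastasisType ψ) {Ψ : ℂ × ℂ → ℂ}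
    (hΨ : AnalyticAt ℂ Ψ 0) (h : ∀ᶠ z in 𝓝 (0 : ℂ), Ψ (z, starRingEnd ℂ z) = ψ z) :
    (∀ᶠ z in 𝓝 (0 : ℂ), Ψ (z, 0) = Ψ 0) ∧ ∀ᶠ w in 𝓝 (0 : ℂ), Ψ (0, w) = Ψ 0 := by
  obtain ⟨a, hsum, ha⟩ := hψ
  -- The expansion of `ψ` with `z̄` replaced by `w`. Holomorphy along complex lines suffices to
  -- identify it with `Ψ`, and follows from the Weierstrass test.
  let A (p : ℂ × ℂ) : ℂ := ∑' i : ℕ × ℕ, a i.1 i.2 * p.1 ^ i.1 * p.2 ^ i.2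
  obtain ⟨ρ, hρ, hAρ⟩ : ∃ ρ > 0, LineDifferentiableOn A ρ := by
    obtain ⟨δ, hδ, hball⟩ := Metric.eventually_nhds_iff_ball.mp hsum
    refine ⟨δ / 2, by positivity, fun p v => ?_⟩
    have hδ2 : ((δ / 2 : ℝ) : ℂ) ∈ Metric.ball (0 : ℂ) δ := by
      rw [mem_ball_zero_iff, Complex.norm_real, Real.norm_eq_abs, abs_of_pos (by positivity)]
      linarith
    -- Absolute convergence at the real point `δ / 2` dominates the terms on the whole bidisc of
    -- that radius.
    have hs := (hball _ hδ2).summable.norm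
    refine Complex.differentiableOn_tsum_of_summable_norm hs (fun i => by fun_prop)
      (Metric.isOpen_ball.preimage (by fun_prop)) fun i t ht => ?_
    have ht' : p + t • v ∈ Metric.ball (0 : ℂ × ℂ) (δ / 2) := ht
    rw [mem_ball_zero_iff, Prod.norm_def, max_lt_iff] at ht'
    rw [norm_mul, norm_mul, norm_pow, norm_pow, norm_mul, norm_mul, norm_pow, norm_pow,
      RCLike.norm_conj, Complex.norm_real, Real.norm_eq_abs, abs_of_pos (by positivity)]
    gcongr
    exacts [ht'.1.le, ht'.2.le]
  obtain ⟨r, hr, hΨr⟩ := exists_lineDifferentiableOn_of_analyticAt hΨ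
  have hF : LineDifferentiableOn (fun p => Ψ p - A p) (min r ρ) := fun p v =>
    (hΨr.mono (min_le_left _ _) p v).sub (hAρ.mono (min_le_right _ _) p v)
  have hΨA := eventuallyEq_zero_of_conj (lt_min hr hρ) hF (by
    filter_upwards [h, hsum] with z hz hz'
    rw [hz, sub_eq_zero]
    exact hz'.tsum_eq.symm)
  have hA1 (z : ℂ) : A (z, 0) = a 0 0 := by
    refine (tsum_eq_single (0, 0) fun i hi => ?_).trans (by simp)
    rcases Nat.eq_zero_or_pos i.2 with h2 | h2
    · have h1 : 0 < i.1 := Nat.pos_of_ne_zero fun h1 => hi (Prod.ext h1 h2)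
      simp [h2, (ha _ h1).1]
    · simp [h2.ne']
  have hA2 (w : ℂ) : A (0, w) = a 0 0 := by
    refine (tsum_eq_single (0, 0) fun i hi => ?_).trans (by simp)
    rcases Nat.eq_zero_or_pos i.1 with h1 | h1
    · have h2 : 0 < i.2 := Nat.pos_of_ne_zero fun h2 => hi (Prod.ext h1 h2)
      simp [h1, (ha _ h2).2]
    · simp [h1.ne']
  have h00 : Ψ 0 = a 0 0 := (sub_eq_zero.mp hΨA.self_of_nhds).trans (hA1 0)
  have ht1 : Tendsto (fun z : ℂ => (z, (0 : ℂ))) (𝓝 0) (𝓝 0) :=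
    Continuous.tendsto' (by fun_prop) _ _ rfl
  have ht2 : Tendsto (fun z : ℂ => ((0 : ℂ), z)) (𝓝 0) (𝓝 0) :=
    Continuous.tendsto' (by fun_prop) _ _ rfl
  exact ⟨(ht1.eventually hΨA).mono fun z hz => by rw [sub_eq_zero.mp hz, hA1, h00],
    (ht2.eventually hΨA).mono fun z hz => by rw [sub_eq_zero.mp hz, hA2, h00]⟩

/-! ### Taylor series in two variables and polarisation of the class -/

section

open PowerSeries

/-- The Taylor series at the origin of a function of one variable. -/
noncomputable def taylorOne : GermHom ℂ ℂ⟦X⟧ := (GermHom.evalZero ℂ).taylor 1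

/-- The Taylor series at the origin of a function of `(z, w)`, as a power series in `w` whose
coefficients are power series in `z`. -/
noncomputable def taylorTwo : GermHom (ℂ × ℂ) ℂ⟦X⟧⟦X⟧ :=
  (taylorOne.pullback (ContinuousLinearMap.inl ℂ ℂ ℂ)).taylor (0, 1)

theorem constantCoeff_taylorOne (f : ℂ → ℂ) : constantCoeff (taylorOne f) = f 0 :=
  GermHom.constantCoeff_taylor (GermHom.evalZero ℂ) 1 f

theorem constantCoeff_taylorTwo (f : ℂ × ℂ → ℂ) :
    constantCoeff (taylorTwo f) = taylorOne fun z => f (z, 0) :=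
  GermHom.constantCoeff_taylor _ _ _

theorem constantCoeff_constantCoeff_taylorTwo (f : ℂ × ℂ → ℂ) :
    constantCoeff (constantCoeff (taylorTwo f)) = f 0 := by
  rw [constantCoeff_taylorTwo, constantCoeff_taylorOne]
  rfl

theorem iterate_dirDeriv_one (f : ℂ → ℂ) (n : ℕ) :
    (dirDeriv (1 : ℂ))^[n] f = iteratedDeriv n f := by
  rw [iteratedDeriv_eq_iterate]
  rfl

theorem eventuallyEq_zero_of_iterate_dirDeriv {f : ℂ → ℂ} (hf : AnalyticAt ℂ f 0)
    (h : ∀ n, (dirDeriv (1 : ℂ))^[n] f 0 = 0) : f =ᶠ[𝓝 0] fun _ => 0 := by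
  rw [EventuallyEq, ← analyticOrderAt_eq_top, ENat.eq_top_iff_forall_ge]
  intro n
  rw [natCast_le_analyticOrderAt_iff_iteratedDeriv_eq_zero hf]
  exact fun i _ => by rw [← iterate_dirDeriv_one, h]

theorem eventuallyEq_zero_of_taylorOne_eq_zero {f : ℂ → ℂ} (hf : AnalyticAt ℂ f 0)
    (h : taylorOne f = 0) : f =ᶠ[𝓝 0] fun _ => 0 := by
  refine eventuallyEq_zero_of_iterate_dirDeriv hf fun n => ?_
  have h1 : coeff n (taylorOne f) = 0 := by rw [h, map_zero]
  have h2 := (GermHom.coeff_taylorFun (GermHom.evalZero ℂ) 1 f n).symm.trans h1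
  exact (smul_eq_zero.mp h2).resolve_left (inv_ne_zero (by exact_mod_cast n.factorial_ne_zero))

/-- The hypothesis says that each w-derivative of `f` on the axis `w = 0` has zero Taylor series in
z. The identity theorem makes it vanish on a disc independent of the order, and then `f(z, ·)`
vanishes for every z in that disc. -/
theorem eventuallyEq_zero_of_taylorTwo_eq_zero {f : ℂ × ℂ → ℂ} (hf : AnalyticAt ℂ f 0)
    (h : taylorTwo f = 0) : f =ᶠ[𝓝 0] fun _ => 0 := by
  obtain ⟨r, hr, hball⟩ := Metric.eventually_nhds_iff_ball.mp hf.eventually_analyticAt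
  have hmem {z w : ℂ} (hz : z ∈ Metric.ball (0 : ℂ) r) (hw : w ∈ Metric.ball (0 : ℂ) r) :
      (z, w) ∈ Metric.ball (0 : ℂ × ℂ) r := by
    rw [mem_ball_zero_iff] at hz hw
    rw [mem_ball_zero_iff, Prod.norm_def]
    exact max_lt hz hw
  have h0 : (0 : ℂ) ∈ Metric.ball (0 : ℂ) r := Metric.mem_ball_self hr
  have hcoeff (n : ℕ) : Set.EqOn (fun z => (dirDeriv ((0, 1) : ℂ × ℂ))^[n] f (z, 0)) 0
      (Metric.ball 0 r) := by
    have han : AnalyticOnNhd ℂ (fun z => (dirDeriv ((0, 1) : ℂ × ℂ))^[n] f (z, 0))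
        (Metric.ball 0 r) := fun z hz =>
      (analyticAt_dirDeriv_iterate (hball _ (hmem hz h0)) n).comp_of_eq
        (analyticAt_id.prod analyticAt_const) rfl
    refine han.eqOn_zero_of_preconnected_of_eventuallyEq_zero
      (convex_ball 0 r).isPreconnected h0 (eventuallyEq_zero_of_taylorOne_eq_zero (han 0 h0) ?_)
    have h1 : coeff n (taylorTwo f) = 0 := by rw [h, map_zero]
    have h2 := (GermHom.coeff_taylorFun _ _ f n).symm.trans h1
    exact (smul_eq_zero.mp h2).resolve_left (inv_ne_zero (by exact_mod_cast n.factorial_ne_zero))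
  have hslice (n : ℕ) {z : ℂ} (hz : z ∈ Metric.ball (0 : ℂ) r) :
      (dirDeriv (1 : ℂ))^[n] (fun w => f (z, w)) =ᶠ[𝓝 0]
        fun w => (dirDeriv ((0, 1) : ℂ × ℂ))^[n] f (z, w) := by
    induction n with
    | zero => exact EventuallyEq.rfl
    | succ n ih =>
      rw [Function.iterate_succ_apply', Function.iterate_succ_apply']
      refine (dirDeriv_congr ih).trans ?_
      have hev : ∀ᶠ w in 𝓝 (0 : ℂ),
          AnalyticAt ℂ ((dirDeriv ((0, 1) : ℂ × ℂ))^[n] f) (z, w) := by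
        filter_upwards [Metric.ball_mem_nhds (0 : ℂ) hr] with w hw
        exact analyticAt_dirDeriv_iterate (hball _ (hmem hz hw)) n
      filter_upwards [hev] with w hw
      have h1 : HasFDerivAt (fun w : ℂ => (z, w)) (ContinuousLinearMap.inr ℂ ℂ ℂ) w :=
        hasFDerivAt_prodMk_right z w
      have h2 := (hw.differentiableAt.hasFDerivAt.comp w h1).fderiv
      simp only [Function.comp_def] at h2
      simp [dirDeriv, h2]
  have hzero {z w : ℂ} (hz : z ∈ Metric.ball (0 : ℂ) r) (hw : w ∈ Metric.ball (0 : ℂ) r) :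
      f (z, w) = 0 := by
    have han : AnalyticOnNhd ℂ (fun w => f (z, w)) (Metric.ball 0 r) := fun w hw =>
      (hball _ (hmem hz hw)).comp_of_eq (analyticAt_const.prod analyticAt_id) rfl
    refine han.eqOn_zero_of_preconnected_of_eventuallyEq_zero
      (convex_ball 0 r).isPreconnected h0 (eventuallyEq_zero_of_iterate_dirDeriv (han 0 h0)
        fun n => ?_) hw
    rw [(hslice n hz).self_of_nhds]
    exact hcoeff n hz
  filter_upwards [Metric.ball_mem_nhds (0 : ℂ × ℂ) hr] with p hp
  rw [mem_ball_zero_iff, Prod.norm_def, max_lt_iff] at hp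
  exact hzero (by simpa using hp.1) (by simpa using hp.2)

theorem taylorTwo_fst {f : ℂ → ℂ} (hf : AnalyticAt ℂ f 0) :
    taylorTwo (fun p => f p.1) = C (taylorOne f) := by
  refine GermHom.taylor_of_dirDeriv_eq_zero _ ?_
  refine (dirDeriv_comp (ContinuousLinearMap.fst ℂ ℂ ℂ) hf).trans
    (Eventually.of_forall fun p => ?_)
  simp [dirDeriv]

theorem taylorTwo_snd {g : ℂ → ℂ} (hg : AnalyticAt ℂ g 0) :
    taylorTwo (fun p => g p.2) = PowerSeries.map (algebraMap ℂ ℂ⟦X⟧) (taylorOne g) := by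
  ext1 n
  rw [coeff_map]
  induction n generalizing g with
  | zero =>
    rw [coeff_zero_eq_constantCoeff_apply, coeff_zero_eq_constantCoeff_apply,
      constantCoeff_taylorTwo, constantCoeff_taylorOne]
    exact taylorOne.map_const (g 0)
  | succ n ih =>
    have h : taylorTwo (dirDeriv (0, 1) fun p => g p.2) =
        taylorTwo fun p => dirDeriv (1 : ℂ) g p.2 :=
      taylorTwo.congr' (dirDeriv_comp (ContinuousLinearMap.snd ℂ ℂ ℂ) hg)
    rw [taylorTwo, GermHom.coeff_succ_taylor, ← taylorTwo, h, ih (analyticAt_dirDeriv hg),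
      taylorOne, GermHom.coeff_succ_taylor, smul_eq_mul, _root_.map_mul, Algebra.smul_def]

theorem constantCoeff_coeff_taylorTwo {f : ℂ × ℂ → ℂ} (hf : AnalyticAt ℂ f 0) (n : ℕ) :
    constantCoeff (coeff n (taylorTwo f)) = coeff n (taylorOne fun w => f (0, w)) := by
  induction n generalizing f with
  | zero =>
    rw [coeff_zero_eq_constantCoeff_apply, coeff_zero_eq_constantCoeff_apply,
      constantCoeff_constantCoeff_taylorTwo, constantCoeff_taylorOne]
    rfl
  | succ n ih =>
    have h : taylorOne (dirDeriv 1 fun w => f (0, w)) =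
        taylorOne fun w => dirDeriv ((0, 1) : ℂ × ℂ) f (0, w) :=
      taylorOne.congr' (dirDeriv_comp (ContinuousLinearMap.inr ℂ ℂ ℂ) hf)
    rw [taylorTwo, GermHom.coeff_succ_taylor, ← taylorTwo, taylorOne, GermHom.coeff_succ_taylor,
      ← taylorOne, h, ← ih (analyticAt_dirDeriv hf)]
    simp [Algebra.smul_def]

theorem derivative_taylorTwo (f : ℂ × ℂ → ℂ) :
    derivative ℂ⟦X⟧ (taylorTwo f) = taylorTwo (dirDeriv (0, 1) f) :=
  GermHom.derivative_taylor _ _ _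

theorem analyticAt_conj_conj {f : ℂ → ℂ} (hf : AnalyticAt ℂ f 0) :
    AnalyticAt ℂ (fun w => starRingEnd ℂ (f (starRingEnd ℂ w))) 0 := by
  rw [Complex.analyticAt_iff_eventually_differentiableAt] at hf ⊢
  have ht : Tendsto (starRingEnd ℂ) (𝓝 0) (𝓝 0) :=
    Complex.continuous_conj.tendsto' 0 0 (map_zero _)
  filter_upwards [ht.eventually hf] with w hw
  have := hw.conj_conj
  rwa [Complex.conj_conj] at this

/-- Every member of the class `ℱ` polarises to a holomorphic function whose Taylor series is
algebraic over the functions of each of the two variables. -/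
theorem exists_polarisation {ψ : ℂ → ℝ} (hψ : ψ ∈ ClassF) :
    ∃ Ψ : ℂ × ℂ → ℂ, AnalyticAt ℂ Ψ 0 ∧
      (∀ᶠ z in 𝓝 (0 : ℂ), Ψ (z, starRingEnd ℂ z) = ψ z) ∧
      ∃ s G : Set ℂ⟦X⟧, IsAlgebraic
        (Algebra.adjoin ℂ (C '' s ∪ PowerSeries.map (algebraMap ℂ ℂ⟦X⟧) '' G)) (taylorTwo Ψ) := by
  obtain ⟨m, -, V, ξ, f, ⟨hVo, -, W, ξt, -, hVW, hnash, hext⟩, hf, h0, hψ⟩ := hψ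
  -- The conjugate of `f j` at `z` becomes a holomorphic function of `w` alone.
  let h : Fin m ⊕ Fin m → ℂ × ℂ → ℂ := Sum.elim (fun j p => f j p.1)
    fun j p => starRingEnd ℂ (f j (starRingEnd ℂ p.2))
  have hh (i : Fin m ⊕ Fin m) : AnalyticAt ℂ (h i) 0 := by
    cases i with
    | inl j => exact (hf j).comp_of_eq analyticAt_fst rfl
    | inr j => exact (analyticAt_conj_conj (hf j)).comp_of_eq analyticAt_snd rfl
  have hdiag (z : ℂ) : (fun i => h i (z, starRingEnd ℂ z)) = diag fun j => f j z := by
    ext i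
    cases i <;> simp [h, diag]
  have hh0 : (fun i => h i 0) = diag fun j => f j 0 := by
    have := hdiag 0
    rwa [map_zero] at this
  have hnash0 : IsNashAt ξt fun i => h i 0 := hh0 ▸ hnash _ (hVW _ h0)
  refine ⟨fun p => ξt fun i => h i p, ?_, ?_, Set.range fun j => taylorOne (f j),
    Set.range fun j => taylorOne fun w => starRingEnd ℂ (f j (starRingEnd ℂ w)), ?_⟩
  · exact AnalyticAt.comp_of_eq (g := ξt) (f := fun p i => h i p) hnash0.1 (AnalyticAt.pi hh) rfl
  · have hV : ∀ᶠ z in 𝓝 (0 : ℂ), (fun j => f j z) ∈ V :=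
      (continuousAt_pi.mpr fun j => (hf j).continuousAt).eventually (hVo.mem_nhds h0)
    filter_upwards [hψ, hV] with z hz hzV
    rw [hdiag, hext _ hzV, hz]
  · have hrange : (Set.range fun i => taylorTwo (h i)) =
        C '' (Set.range fun j => taylorOne (f j)) ∪ PowerSeries.map (algebraMap ℂ ℂ⟦X⟧) ''
          Set.range fun j => taylorOne fun w => starRingEnd ℂ (f j (starRingEnd ℂ w)) := by
      rw [Sum.range_eq, ← Set.range_comp, ← Set.range_comp]
      congr 2
      · ext1 j
        exact taylorTwo_fst (hf j)
      · ext1 j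
        exact taylorTwo_snd (analyticAt_conj_conj (hf j))
    rw [← hrange]
    let η : ℂ⟦X⟧⟦X⟧ →ₐ[ℂ] ℂ :=
      { (constantCoeff (R := ℂ)).comp (constantCoeff (R := ℂ⟦X⟧)) with
        commutes' := fun c => by simp [PowerSeries.algebraMap_apply] }
    exact isAlgebraic_of_isNashAt taylorTwo η
      (fun f _ => constantCoeff_constantCoeff_taylorTwo f) hh hnash0

/-- The change of coefficients from power series to their fractions. -/
noncomputable def toFractions : ℂ⟦X⟧⟦X⟧ →+* (FractionRing ℂ⟦X⟧)⟦X⟧ :=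
  PowerSeries.map (algebraMap ℂ⟦X⟧ (FractionRing ℂ⟦X⟧))

theorem algebraMap_fractions_C (c : ℂ) :
    algebraMap ℂ⟦X⟧ (FractionRing ℂ⟦X⟧) (C c) = algebraMap ℂ (FractionRing ℂ⟦X⟧) c :=
  (IsScalarTower.algebraMap_apply ℂ ℂ⟦X⟧ (FractionRing ℂ⟦X⟧) c).symm

theorem toFractions_algebraMap (c : ℂ) :
    toFractions (algebraMap ℂ ℂ⟦X⟧⟦X⟧ c) = algebraMap ℂ (FractionRing ℂ⟦X⟧)⟦X⟧ c := by
  rw [PowerSeries.algebraMap_apply, PowerSeries.algebraMap_apply, toFractions, map_C,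
    Algebra.algebraMap_self_apply, algebraMap_fractions_C, PowerSeries.algebraMap_apply]

/-- Coefficients must lie in a field for the transcendence basis argument. Enlarging `s` and `G`
lets all the functions share the same two sets of variables. -/
theorem isAlgebraic_toFractions {s s' G G' : Set ℂ⟦X⟧} (hs : s ⊆ s') (hG : G ⊆ G') {x : ℂ⟦X⟧⟦X⟧}
    (hx : IsAlgebraic
      (Algebra.adjoin ℂ (C '' s ∪ PowerSeries.map (algebraMap ℂ ℂ⟦X⟧) '' G)) x) :
    IsAlgebraic (Algebra.adjoin ℂ (C '' (algebraMap ℂ⟦X⟧ (FractionRing ℂ⟦X⟧) '' s') ∪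
      PowerSeries.map (algebraMap ℂ (FractionRing ℂ⟦X⟧)) '' G')) (toFractions x) := by
  set R := Algebra.adjoin ℂ (C '' (algebraMap ℂ⟦X⟧ (FractionRing ℂ⟦X⟧) '' s') ∪
      PowerSeries.map (algebraMap ℂ (FractionRing ℂ⟦X⟧)) '' G')
  have hmem {y : (FractionRing ℂ⟦X⟧)⟦X⟧} (hy : y ∈ R) : IsAlgebraic R y :=
    isAlgebraic_algebraMap (⟨y, hy⟩ : R)
  refine isAlgebraic_map_of_isAlgebraic_adjoin (φ := toFractions)
    (PowerSeries.map_injective _ (IsFractionRing.injective _ _)) (fun c => ?_) ?_ hx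
  · rw [toFractions_algebraMap]
    exact hmem (R.algebraMap_mem c)
  · rintro _ (⟨a, ha, rfl⟩ | ⟨g, hg, rfl⟩)
    · rw [toFractions, map_C]
      exact hmem (Algebra.subset_adjoin (Or.inl ⟨_, ⟨a, hs ha, rfl⟩, rfl⟩))
    · have : toFractions (PowerSeries.map (algebraMap ℂ ℂ⟦X⟧) g) =
          PowerSeries.map (algebraMap ℂ (FractionRing ℂ⟦X⟧)) g := by
        ext n
        simp [toFractions, algebraMap_fractions_C]
      rw [this]
      exact hmem (Algebra.subset_adjoin (Or.inr ⟨g, hG hg, rfl⟩))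

/-! ### Logarithms of the product and the conclusion -/

/-- For negative bases both powers carry the same factor `cos (π μ)`, nonzero by `hx`, and its
logarithm cancels in the difference. -/
theorem log_rpow_sub_log_rpow {x y μ : ℝ} (hxy : 0 < x / y) (hx : x ^ μ ≠ 0) :
    Real.log (x ^ μ) - Real.log (y ^ μ) = μ * Real.log (x / y) := by
  rcases div_pos_iff.mp hxy with ⟨h1, h2⟩ | ⟨h1, h2⟩
  · rw [Real.log_rpow h1, Real.log_rpow h2, Real.log_div h1.ne' h2.ne']
    ring
  · rw [Real.rpow_def_of_neg h1] at hx ⊢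
    rw [Real.rpow_def_of_neg h2]
    have hc := right_ne_zero_of_mul hx
    rw [Real.log_mul (Real.exp_ne_zero _) hc, Real.log_mul (Real.exp_ne_zero _) hc, Real.log_exp,
      Real.log_exp, Real.log_div h1.ne h2.ne]
    ring

theorem derivative_toFractions (f : ℂ⟦X⟧⟦X⟧) :
    derivative (FractionRing ℂ⟦X⟧) (toFractions f) = toFractions (derivative ℂ⟦X⟧ f) := by
  ext n
  simp [toFractions, coeff_derivative]

/-- The polarised logarithm of a function of diastasis-type. -/
theorem exists_log_polarisation {Ψ : ℂ × ℂ → ℂ} (hΨ : AnalyticAt ℂ Ψ 0) (h0 : Ψ 0 ≠ 0)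
    (hz : ∀ᶠ z in 𝓝 (0 : ℂ), Ψ (z, 0) = Ψ 0) {ψ : ℂ → ℝ}
    (hψ : ∀ᶠ z in 𝓝 (0 : ℂ), Ψ (z, starRingEnd ℂ z) = ψ z) :
    ∃ Λ : ℂ × ℂ → ℂ, AnalyticAt ℂ Λ 0 ∧ (∀ᶠ z in 𝓝 (0 : ℂ), Λ (z, 0) = 0) ∧
      (∀ᶠ p in 𝓝 (0 : ℂ × ℂ), Ψ p * dirDeriv (0, 1) Λ p = dirDeriv (0, 1) Ψ p) ∧
      ∀ᶠ z in 𝓝 (0 : ℂ), 0 < ψ z / ψ 0 ∧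
        Λ (z, starRingEnd ℂ z) = (Real.log (ψ z / ψ 0) : ℝ) := by
  have hq : AnalyticAt ℂ (fun p => Ψ p / Ψ 0) 0 := hΨ.fun_div analyticAt_const h0
  -- Normalizing the value at the origin to 1 makes the principal logarithm available whatever the
  -- sign of `Ψ 0`.
  have hq0 : Ψ 0 / Ψ 0 ∈ Complex.slitPlane := by
    rw [div_self h0]
    exact Complex.one_mem_slitPlane
  have hslit : ∀ᶠ p in 𝓝 (0 : ℂ × ℂ), Ψ p / Ψ 0 ∈ Complex.slitPlane :=
    hq.continuousAt.eventually (Complex.isOpen_slitPlane.mem_nhds hq0)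
  refine ⟨fun p => Complex.log (Ψ p / Ψ 0), hq.clog hq0, ?_, ?_, ?_⟩
  · filter_upwards [hz] with z hz
    rw [hz, div_self h0, Complex.log_one]
  · filter_upwards [hslit, hΨ.eventually_analyticAt] with p hp hpa
    have hne : Ψ p ≠ 0 := fun h => Complex.slitPlane_ne_zero hp (by rw [h, zero_div])
    have h1 := (hpa.differentiableAt.hasFDerivAt.mul_const (Ψ 0)⁻¹)
    simp only [← div_eq_mul_inv] at h1
    have h2 := (h1.clog hp).fderiv
    simp only [dirDeriv, h2, smul_apply, smul_eq_mul]
    field_simp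
  · have hψ0 : Ψ 0 = ψ 0 := by
      have := hψ.self_of_nhds
      rwa [map_zero] at this
    have ht : Tendsto (fun z : ℂ => Ψ (z, starRingEnd ℂ z) / Ψ 0) (𝓝 0) (𝓝 1) := by
      have h1 : Tendsto (fun z : ℂ => (z, starRingEnd ℂ z)) (𝓝 0) (𝓝 0) :=
        (continuous_id.prodMk Complex.continuous_conj).tendsto' _ _ (by simp)
      have h2 := hq.continuousAt.tendsto.comp h1
      rwa [div_self h0] at h2
    have hre := (Complex.continuous_re.tendsto 1).comp ht
    filter_upwards [hψ, hre.eventually (lt_mem_nhds (by simp : (0 : ℝ) < (1 : ℂ).re))] with z hz hpos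
    simp only [Function.comp_apply, hz, hψ0, ← Complex.ofReal_div, Complex.ofReal_re] at hpos
    refine ⟨hpos, ?_⟩
    rw [hz, hψ0, ← Complex.ofReal_div, Complex.ofReal_log hpos.le]

theorem GermHom.map_const_add_sum {E A : Type*} [NormedAddCommGroup E] [NormedSpace ℂ E]
    [CommRing A] [Algebra ℂ A] (T : GermHom E A) {ι : Type*} [Fintype ι] {Λ : ι → E → ℂ}
    (hΛ : ∀ i, AnalyticAt ℂ (Λ i) 0) (c : ℂ) (μ : ι → ℂ) :
    T (fun p => c + ∑ i, μ i * Λ i p) = algebraMap ℂ A c + ∑ i, μ i • T (Λ i) := by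
  have := (T.eval_mvPolynomial Λ hΛ
    (MvPolynomial.C c + ∑ i, MvPolynomial.C (μ i) * MvPolynomial.X i)).2
  simpa [Algebra.smul_def] using this

/-- If the exponential of a function in `ℱ̃` is a product of nonzero real powers of functions in
`ℱ̃`, then it is constant. -/
theorem mem_constants_of_exp_eq_prod {ψ₀ : ℂ → ℝ} (hψ₀ : ψ₀ ∈ ClassFTilde) {ι : Type*} [Fintype ι]
    (μ : ι → ℝ) (hμ : ∀ i, μ i ≠ 0) (ψ : ι → ℂ → ℝ) (hψ : ∀ i, ψ i ∈ ClassFTilde)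
    (h : ∀ᶠ z in 𝓝 (0 : ℂ), Real.exp (ψ₀ z) = ∏ i, ψ i z ^ μ i) : ψ₀ ∈ Constants := by
  obtain ⟨Ψ₀, hΨ₀, hΨψ₀, s₀, G₀, halg₀⟩ := exists_polarisation hψ₀.1
  choose Ψ hΨ hΨψ s G halg using fun i => exists_polarisation (hψ i).1
  obtain ⟨-, hw₀⟩ := hψ₀.2.eventually_eq_const hΨ₀ hΨψ₀
  have hz (i : ι) := ((hψ i).2.eventually_eq_const (hΨ i) (hΨψ i)).1
  have hpow : ∀ᶠ z in 𝓝 (0 : ℂ), ∀ i, ψ i z ^ μ i ≠ 0 := by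
    filter_upwards [h] with z hz i
    have h1 : ∏ i, ψ i z ^ μ i ≠ 0 := hz ▸ (Real.exp_pos _).ne'
    exact Finset.prod_ne_zero_iff.mp h1 i (Finset.mem_univ i)
  have hval₀ : Ψ₀ 0 = ψ₀ 0 := by
    have := hΨψ₀.self_of_nhds
    rwa [map_zero] at this
  have hval (i : ι) : Ψ i 0 = ψ i 0 := by
    have := (hΨψ i).self_of_nhds
    rwa [map_zero] at this
  -- As `μ i ≠ 0`, a zero of `ψ i` at the origin would annihilate the product, which equals a
  -- positive exponential.
  have hne (i : ι) : Ψ i 0 ≠ 0 := by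
    rw [hval, Complex.ofReal_ne_zero]
    intro h0
    exact hpow.self_of_nhds i (by rw [h0, Real.zero_rpow (hμ i)])
  choose Λ hΛ hΛ0 hΛd hΛψ using fun i => exists_log_polarisation (hΨ i) (hne i) (hz i) (hΨψ i)
  have hsum : AnalyticAt ℂ (fun p => ∑ i, (μ i : ℂ) * Λ i p) 0 :=
    Finset.univ.analyticAt_fun_sum fun i _ => analyticAt_const.fun_mul (hΛ i)
  have hpolar : Ψ₀ =ᶠ[𝓝 0] fun p => Ψ₀ 0 + ∑ i, (μ i : ℂ) * Λ i p := by
    have hF : AnalyticAt ℂ (fun p => Ψ₀ p - (Ψ₀ 0 + ∑ i, (μ i : ℂ) * Λ i p)) 0 :=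
      hΨ₀.fun_sub (analyticAt_const.fun_add hsum)
    refine (eventuallyEq_zero_of_analyticAt_of_conj hF ?_).mono fun p hp => sub_eq_zero.mp hp
    filter_upwards [hΨψ₀, h, hpow, eventually_all.mpr hΛψ] with z h1 h2 h3 h4
    have h5 : ψ₀ z = ψ₀ 0 + ∑ i, μ i * Real.log (ψ i z / ψ i 0) := by
      have h6 := congrArg Real.log h2
      have h7 := congrArg Real.log h.self_of_nhds
      rw [Real.log_exp, Real.log_prod fun i _ => h3 i] at h6
      rw [Real.log_exp, Real.log_prod fun i _ => hpow.self_of_nhds i] at h7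
      rw [h6, h7, ← sub_eq_iff_eq_add', ← Finset.sum_sub_distrib]
      exact Finset.sum_congr rfl fun i _ => log_rpow_sub_log_rpow (h4 i).1 (h3 i)
    rw [h1, hval₀, h5]
    simp [fun i => (h4 i).2]
  let K := FractionRing ℂ⟦X⟧
  let s' := s₀ ∪ ⋃ i, s i
  let G' := G₀ ∪ ⋃ i, G i
  have hcc {f : ℂ × ℂ → ℂ} {c : ℂ} (hf : ∀ᶠ z in 𝓝 (0 : ℂ), f (z, 0) = c) :
      constantCoeff (toFractions (taylorTwo f)) = algebraMap ℂ K c := by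
    have h1 : constantCoeff (taylorTwo f) = C c := by
      rw [constantCoeff_taylorTwo, taylorOne.congr' hf, taylorOne.map_const]
      rfl
    rw [← algebraMap_fractions_C, ← h1, toFractions, ← coeff_zero_eq_constantCoeff_apply, coeff_map,
      coeff_zero_eq_constantCoeff_apply]
  have hsmul (c : ℂ) (f : ℂ⟦X⟧⟦X⟧) : toFractions (c • f) = c • toFractions f := by
    rw [Algebra.smul_def, map_mul, toFractions_algebraMap, Algebra.smul_def]
  have key := coeff_mem_range_of_eq_sum_log (algebraMap ℂ⟦X⟧ K '' s') G' (fun i => (μ i : ℂ))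
    (toFractions (taylorTwo Ψ₀)) (fun i => toFractions (taylorTwo (Ψ i)))
    (fun i => toFractions (taylorTwo (Λ i))) (Ψ₀ 0) (fun i => Ψ i 0)
    (isAlgebraic_toFractions Set.subset_union_left Set.subset_union_left halg₀)
    (fun i => isAlgebraic_toFractions
      ((Set.subset_iUnion s i).trans Set.subset_union_right)
      ((Set.subset_iUnion G i).trans Set.subset_union_right) (halg i))
    (fun i => hcc (hz i)) hne
    (fun i => by
      rw [derivative_toFractions, derivative_toFractions, ← map_mul, derivative_taylorTwo,
        derivative_taylorTwo, ← taylorTwo.map_mul (hΨ i) (analyticAt_dirDeriv (hΛ i)),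
        taylorTwo.congr' (hΛd i)])
    (fun i => by rw [hcc (hΛ0 i), map_zero])
    (by
      rw [taylorTwo.congr' hpolar, taylorTwo.map_const_add_sum hΛ, map_add, map_sum,
        toFractions_algebraMap]
      simp only [hsmul]
      rfl)
  -- Each coefficient in `w` is constant in `z`, hence equal to its value at `z = 0`, where `Ψ₀(0,
  -- w) = Ψ₀ 0`.
  have hconst : taylorTwo Ψ₀ = algebraMap ℂ ℂ⟦X⟧⟦X⟧ (Ψ₀ 0) := by
    have h1 (n : ℕ) : coeff n (taylorTwo Ψ₀) = C (constantCoeff (coeff n (taylorTwo Ψ₀))) := by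
      obtain ⟨c, hc⟩ := key n
      rw [toFractions, coeff_map, ← algebraMap_fractions_C] at hc
      rw [← IsFractionRing.injective ℂ⟦X⟧ K hc, constantCoeff_C]
    ext1 n
    rw [h1, constantCoeff_coeff_taylorTwo hΨ₀, taylorOne.congr' hw₀, taylorOne.map_const,
      PowerSeries.algebraMap_apply, PowerSeries.algebraMap_apply, coeff_C, coeff_C]
    split_ifs <;> simp
  have hΨconst : ∀ᶠ p in 𝓝 (0 : ℂ × ℂ), Ψ₀ p + -Ψ₀ 0 = 0 := by
    refine eventuallyEq_zero_of_taylorTwo_eq_zero (hΨ₀.fun_add analyticAt_const) ?_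
    rw [taylorTwo.map_add hΨ₀ analyticAt_const, taylorTwo.map_const, hconst, map_neg,
      add_neg_cancel]
  refine ⟨ψ₀ 0, ?_⟩
  have ht : Tendsto (fun z : ℂ => (z, starRingEnd ℂ z)) (𝓝 0) (𝓝 0) :=
    (continuous_id.prodMk Complex.continuous_conj).tendsto' _ _ (by simp)
  filter_upwards [hΨψ₀, ht.eventually hΨconst] with z h1 h2
  rw [add_neg_eq_zero, h1, hval₀] at h2
  exact_mod_cast h2

end

end NashDiastasis

theorem mainTheorem2 (ψ₀ : ℂ → ℝ)
    (hψ₀ : ψ₀ ∈ NashDiastasis.ClassFTilde \ NashDiastasis.Constants)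
    (ℓ : ℕ) (μ : Fin ℓ → ℝ) :
    (fun z => Real.exp (ψ₀ z)) ∉ NashDiastasis.PowProd μ \ NashDiastasis.Constants := by
  rintro ⟨⟨ψ, hψ, h⟩, -⟩
  -- Factors with exponent zero equal 1 even where `ψ i` vanishes, since `0 ^ 0 = 1`. They are
  -- dropped because the logarithm needs `ψ i 0 ≠ 0`.
  refine hψ₀.2 (NashDiastasis.mem_constants_of_exp_eq_prod hψ₀.1
    (fun i : {i // μ i ≠ 0} => μ i) (fun i => i.2) (fun i => ψ i) (fun i => hψ i) ?_)
  filter_upwards [h] with z hz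
  rw [hz, ← Fintype.prod_subtype_mul_prod_subtype (fun i => μ i ≠ 0),
    Finset.prod_eq_one (s := (Finset.univ : Finset {i // ¬μ i ≠ 0})), mul_one]
  intro i _
  rw [not_not.mp i.2, Real.rpow_zero]
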